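/- **Setting.** Let $\mathbb S^n$ be the real inner product space of $n\times n$ real symmetric matrices, or of $n\times n$ complex Hermitian matrices, with the trace inner product $\langle X,Y\rangle=\mathrm{Re}\,\mathrm{Tr}(X^{\mathbb T}Y)$ and Frobenius norm $\|\cdot\|_F$, where $^{\mathbb T}$ denotes the transpose in the real case and the conjugate transpose in the complex case. Let $\mathbb S^n_+$ and $\mathbb S^n_{++}$ denote the positive semidefinite and positive definite matrices in $\mathbb S^n$. Let $\Theta_1,\dots,\Theta_d$ be an orthonormal basis of $\mathbb S^n$, let $\alpha\subseteq\{1,\dots,d\}$ with complement $\beta$, and let $\overline X\in\mathbb S^n_+$ have rank $r\ge 1$. The indices $\omega_1,\omega_2,\dots$ are i.i.d. with $\Pr(\omega_i=k)=p_k$, where $p_k=0$ for $k\in\alpha$ and $p_k>0$ for $k\in\beta$. The noises $\xi_1,\xi_2,\dots$ are i.i.d. real random variables with $\mathbb E(\xi_i)=0$ and $\mathbb E(\xi_i^2)=1$, and the sequence $(\xi_i)$ is independent of $(\omega_i)$. For a fixed $\nu>0$ one observes $y_i=\langle\Theta_{\omega_i},\overline X\rangle+\nu\xi_i$. Call $f:\mathbb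 R^n\to\mathbb R^n$ symmetric if $f(x)=Q^{\mathbb T}f(Qx)$ for all signed permutation matrices $Q$ and all $x$. Let $F$ be the spectral operator associated with a symmetric $f$, that is, $F(X)=U\,\mathrm{Diag}(f(\sigma(X)))\,V^{\mathbb T}$ for a singular value decomposition $X=U\,\mathrm{Diag}(\sigma(X))\,V^{\mathbb T}$ with singular values in nonincreasing order, and assume that $F:\mathbb S^n\to\mathbb S^n$ is continuous at $\overline X$. Let the initial estimators $\widetilde X_m$ be random matrices in $\mathbb S^n_+$ with $\widetilde X_m\to\overline X$ in probability. Let $\rho_m>0$ be deterministic and let $\gamma_m\ge 0$ be possibly random. For each $m\ge 1$ let the random matrix $\widehat X_m$ be (almost surely) an optimal solution of $$\min_{X}\ \frac1{2m}\sum_{i=1}^m\big(y_i-\langle\Theta_{\omega_i},X\rangle\big)^2+\rho_m\Big(\langle I_n-F(\widetilde X_m),X\rangle+\frac{\gamma_m}2\|X-\widetilde X_m\|_F^2\Big)$$ subject to $X\in\mathbb S^n_+$ and $\langle\Theta_k,X\rangle=\langle\Theta_k,\overline X\rangle$ for all $k\in\alpha$. Assume the Slater condition: there is $X^0\in\mathbb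 S^n_{++}$ with $\langle\Theta_k,X^0\rangle=\langle\Theta_k,\overline X\rangle$ for all $k\in\alpha$. Put $\mathcal Q_\beta^\dagger(X)=\sum_{k\in\beta}p_k^{-1}\langle\Theta_k,X\rangle\Theta_k$. Let $\overline X=\overline P\,\mathrm{Diag}(\lambda)\,\overline P^{\mathbb T}$ be an eigenvalue decomposition with $\overline P$ orthogonal (unitary in the complex case) and $|\lambda_1|\ge\dots\ge|\lambda_n|$, and let $\overline P_2$ consist of the last $n-r$ columns of $\overline P$. **Theorem.** Suppose that $\rho_m\to0$, $\sqrt m\,\rho_m\to\infty$ and $\gamma_m=O_p(1)$ (bounded in probability) as $m\to\infty$. If the linear system $$\overline P_2^{\mathbb T}\mathcal Q_\beta^\dagger\big(\overline P_2\Lambda\overline P_2^{\mathbb T}\big)\overline P_2=\overline P_2^{\mathbb T}\mathcal Q_\beta^\dagger\big(I_n-F(\overline X)\big)\overline P_2$$ has a unique positive definite solution $\widehat\Lambda\in\mathbb S^{n-r}_{++}$, then $\widehat X_m$ is rank consistent, i.e. $\lim_{m\to\infty}\Pr\big(\mathrm{rank}(\widehat X_m)=\mathrm{rank}(\overline X)\big)=1$.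 -/

import Mathlib

open MeasureTheory ProbabilityTheory Filter Topology
open scoped Matrix ComplexOrder

noncomputable section

namespace RankCorrection

/-! ### Spectral operators -/

section Spectral

variable {n : ℕ} {𝕜 : Type*} [RCLike 𝕜]

/-- A signed permutation matrix: every row and every column has exactly one nonzero entry, and that
entry is `1` or `-1`. -/
def IsSignedPermMatrix (Q : Matrix (Fin n) (Fin n) ℝ) : Prop :=
  (∀ i, ∃! j, Q i j ≠ 0) ∧ (∀ j, ∃! i, Q i j ≠ 0) ∧ ∀ i j, Q i j = 0 ∨ Q i j = 1 ∨ Q i j = -1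

/-- `f : ℝⁿ → ℝⁿ` is symmetric: `f x = Qᵀ f (Q x)` for every signed permutation matrix `Q`. -/
def IsSymmetricFun (f : (Fin n → ℝ) → (Fin n → ℝ)) : Prop :=
  ∀ Q : Matrix (Fin n) (Fin n) ℝ, IsSignedPermMatrix Q → ∀ x, f x = Qᵀ *ᵥ f (Q *ᵥ x)

/-- The rectangular-diagonal (here square) matrix with real diagonal `x`, over `𝕜`. -/
def rdiag (𝕜 : Type*) [RCLike 𝕜] (x : Fin n → ℝ) : Matrix (Fin n) (Fin n) 𝕜 :=
  Matrix.diagonal fun i => (x i : 𝕜)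

/-- `X = U Diag(s) Vᴴ` is a singular value decomposition: `U`, `V` are unitary (orthogonal for
`𝕜 = ℝ`) and `s` is nonnegative and nonincreasing. -/
structure IsSVD (X U V : Matrix (Fin n) (Fin n) 𝕜) (s : Fin n → ℝ) : Prop where
  left_unitary : U ∈ Matrix.unitaryGroup (Fin n) 𝕜
  right_unitary : V ∈ Matrix.unitaryGroup (Fin n) 𝕜
  antitone : Antitone s
  nonneg : ∀ i, 0 ≤ s i
  eq : X = U * rdiag 𝕜 s * Vᴴ

open Classical in
/-- The spectral operator `X ↦ U Diag(f(σ(X))) Vᴴ` associated with `f`, where `X = U Diag(σ(X)) Vᴴ`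
is a singular value decomposition. For symmetric `f` the value does not depend on the
decomposition (`spectralOperator_eq`), and a decomposition exists (`exists_isSVD`). -/
def spectralOperator (f : (Fin n → ℝ) → (Fin n → ℝ)) (X : Matrix (Fin n) (Fin n) 𝕜) :
    Matrix (Fin n) (Fin n) 𝕜 :=
  if h : ∃ D : Matrix (Fin n) (Fin n) 𝕜 × Matrix (Fin n) (Fin n) 𝕜 × (Fin n → ℝ),
      IsSVD X D.1 D.2.1 D.2.2
  then h.choose.1 * rdiag 𝕜 (f h.choose.2.2) * (h.choose.2.1)ᴴ else 0

/-- The singular values are determined by the matrix. -/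
theorem IsSVD.unique {X U V U' V' : Matrix (Fin n) (Fin n) 𝕜} {s s' : Fin n → ℝ}
    (h : IsSVD X U V s) (h' : IsSVD X U' V' s') : s = s' := by
  have key : ∀ {U V : Matrix (Fin n) (Fin n) 𝕜} {t : Fin n → ℝ}, IsSVD X U V t →
      (Xᴴ * X).charpoly.roots = Multiset.map (fun i => ((t i ^ 2 : ℝ) : 𝕜)) Finset.univ.val := by
    intro U V t ht
    have hU : Uᴴ * U = 1 := Matrix.mem_unitaryGroup_iff'.1 ht.left_unitary
    have hV : Vᴴ * V = 1 := Matrix.mem_unitaryGroup_iff'.1 ht.right_unitary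
    have hd : (rdiag 𝕜 t)ᴴ * rdiag 𝕜 t = Matrix.diagonal fun i => ((t i ^ 2 : ℝ) : 𝕜) := by
      simp [rdiag, Matrix.diagonal_conjTranspose, Matrix.diagonal_mul_diagonal, pow_two]
    have e : Xᴴ * X = V * ((rdiag 𝕜 t)ᴴ * rdiag 𝕜 t) * Vᴴ := by
      rw [ht.eq]
      simp only [Matrix.conjTranspose_mul, Matrix.conjTranspose_conjTranspose, Matrix.mul_assoc]
      rw [← Matrix.mul_assoc Uᴴ U, hU, Matrix.one_mul]
    rw [e, Matrix.charpoly_mul_comm, ← Matrix.mul_assoc, hV, Matrix.one_mul, hd,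
      Matrix.charpoly_diagonal, Polynomial.roots_prod]
    · simp only [Polynomial.roots_X_sub_C, Multiset.bind_singleton]
    · exact Finset.prod_ne_zero_iff.2 fun i _ => Polynomial.X_sub_C_ne_zero _
  have hroots := (key h).symm.trans (key h')
  have h2 := congrArg (Multiset.map fun z : 𝕜 => Real.sqrt (RCLike.re z)) hroots
  simp only [Multiset.map_map, Function.comp_def, RCLike.ofReal_re] at h2
  have h3 : Multiset.map s Finset.univ.val = Multiset.map s' Finset.univ.val := by
    simpa only [Real.sqrt_sq (h.nonneg _), Real.sqrt_sq (h'.nonneg _)] using h2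
  rw [Fin.univ_val_map, Fin.univ_val_map, Multiset.coe_eq_coe] at h3
  exact List.ofFn_injective (h3.eq_of_pairwise' h.antitone.sortedGE_ofFn.pairwise
    h'.antitone.sortedGE_ofFn.pairwise)

theorem IsSymmetricFun.eq_of_eq {f : (Fin n → ℝ) → (Fin n → ℝ)} (hf : IsSymmetricFun f)
    {x : Fin n → ℝ} {i j : Fin n} (hij : x i = x j) : f x i = f x j := by
  classical
  let τ := Equiv.swap i j
  let Q : Matrix (Fin n) (Fin n) ℝ := Matrix.of fun a b => if τ a = b then 1 else 0
  have hQ : IsSignedPermMatrix Q := by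
    refine ⟨fun a => ⟨τ a, by simp [Q], fun b hb => ?_⟩,
      fun b => ⟨τ.symm b, by simp [Q], fun a ha => ?_⟩, fun a b => ?_⟩
    · by_contra hne
      exact hb (by simp [Q, Ne.symm hne])
    · by_contra hne
      exact ha (by simp [Q, ← Equiv.eq_symm_apply, hne])
    · by_cases hab : τ a = b <;> simp [Q, hab]
  have hmul : ∀ v : Fin n → ℝ, Q *ᵥ v = fun a => v (τ a) := by
    intro v; ext a
    simp [Q, Matrix.mulVec, dotProduct]
  have hmulT : ∀ v : Fin n → ℝ, Qᵀ *ᵥ v = fun a => v (τ.symm a) := by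
    intro v; ext a
    simp [Q, Matrix.mulVec, dotProduct, ← Equiv.eq_symm_apply]
  have hx : Q *ᵥ x = x := by
    rw [hmul]; ext a
    by_cases ha : a = i
    · simp [τ, ha, hij]
    · by_cases hb : a = j
      · simp [τ, hb, hij]
      · simp [τ, Equiv.swap_apply_of_ne_of_ne ha hb]
  have := congrFun (hf Q hQ x) i
  rw [hx, hmulT] at this
  simpa [τ] using this

theorem IsSymmetricFun.eq_zero {f : (Fin n → ℝ) → (Fin n → ℝ)} (hf : IsSymmetricFun f)
    {x : Fin n → ℝ} {i : Fin n} (hi : x i = 0) : f x i = 0 := by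
  classical
  let e : Fin n → ℝ := fun a => if a = i then -1 else 1
  have he : ∀ a, e a = 1 ∨ e a = -1 := fun a => by by_cases ha : a = i <;> simp [e, ha]
  have he0 : ∀ a, e a ≠ 0 := fun a => by rcases he a with h | h <;> simp [h]
  let Q : Matrix (Fin n) (Fin n) ℝ := Matrix.diagonal e
  have hQ : IsSignedPermMatrix Q := by
    refine ⟨fun a => ⟨a, by simp [Q, he0], fun b hb => ?_⟩,
      fun b => ⟨b, by simp [Q, he0], fun a ha => ?_⟩, fun a b => ?_⟩
    · by_contra hne
      exact hb (by simp [Q, Ne.symm hne])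
    · by_contra hne
      exact ha (by simp [Q, hne])
    · by_cases hab : a = b
      · subst hab; simpa [Q] using Or.inr (he a)
      · simp [Q, hab]
  have hx : Q *ᵥ x = x := by
    ext a
    by_cases ha : a = i
    · subst ha; simp [Q, Matrix.mulVec_diagonal, hi]
    · simp [Q, Matrix.mulVec_diagonal, e, ha]
  have := congrFun (hf Q hQ x) i
  rw [hx] at this
  simp [Q, Matrix.mulVec_diagonal, e] at this
  linarith

/-- Well-definedness of the spectral operator. -/
theorem spectralOperator_eq {f : (Fin n → ℝ) → (Fin n → ℝ)} (hf : IsSymmetricFun f)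
    {X U V : Matrix (Fin n) (Fin n) 𝕜} {s : Fin n → ℝ} (h : IsSVD X U V s) :
    spectralOperator f X = U * rdiag 𝕜 (f s) * Vᴴ := by
  have hex : ∃ D : Matrix (Fin n) (Fin n) 𝕜 × Matrix (Fin n) (Fin n) 𝕜 × (Fin n → ℝ),
      IsSVD X D.1 D.2.1 D.2.2 := ⟨(U, V, s), h⟩
  have h' := hex.choose_spec
  rw [spectralOperator, dif_pos hex]
  generalize hex.choose = D at h'
  obtain ⟨U', V', s'⟩ := D
  dsimp only at h' ⊢
  obtain rfl := h.unique h'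
  have hU : Uᴴ * U = 1 := Matrix.mem_unitaryGroup_iff'.1 h.left_unitary
  have hV : Vᴴ * V = 1 := Matrix.mem_unitaryGroup_iff'.1 h.right_unitary
  have hU2 : U * Uᴴ = 1 := Matrix.mem_unitaryGroup_iff.1 h.left_unitary
  have hU' : U'ᴴ * U' = 1 := Matrix.mem_unitaryGroup_iff'.1 h'.left_unitary
  have hV' : V'ᴴ * V' = 1 := Matrix.mem_unitaryGroup_iff'.1 h'.right_unitary
  have hU2' : U' * U'ᴴ = 1 := Matrix.mem_unitaryGroup_iff.1 h'.left_unitary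
  have hV2' : V' * V'ᴴ = 1 := Matrix.mem_unitaryGroup_iff.1 h'.right_unitary
  have hV2 : V * Vᴴ = 1 := Matrix.mem_unitaryGroup_iff.1 h.right_unitary
  have hX := h.eq.symm.trans h'.eq
  set W := U'ᴴ * U with hW
  set Z := V'ᴴ * V with hZ
  have hc : W * rdiag 𝕜 s = rdiag 𝕜 s * Z := by
    calc W * rdiag 𝕜 s = U'ᴴ * (U * rdiag 𝕜 s * Vᴴ) * V := by
          simp only [hW, Matrix.mul_assoc, hV, Matrix.mul_one]
      _ = U'ᴴ * (U' * rdiag 𝕜 s * V'ᴴ) * V := by rw [hX]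
      _ = (U'ᴴ * U') * rdiag 𝕜 s * Z := by simp only [hZ, Matrix.mul_assoc]
      _ = rdiag 𝕜 s * Z := by rw [hU', Matrix.one_mul]
  have hXH := congrArg Matrix.conjTranspose hX
  have hdH : (rdiag 𝕜 s)ᴴ = rdiag 𝕜 s := by
    simp [rdiag, Matrix.diagonal_conjTranspose]
  simp only [Matrix.conjTranspose_mul, Matrix.conjTranspose_conjTranspose, hdH,
    ← Matrix.mul_assoc] at hXH
  have hc' : Z * rdiag 𝕜 s = rdiag 𝕜 s * W := by
    calc Z * rdiag 𝕜 s = V'ᴴ * (V * rdiag 𝕜 s * Uᴴ) * U := by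
          simp only [hZ, Matrix.mul_assoc, hU, Matrix.mul_one]
      _ = V'ᴴ * (V' * rdiag 𝕜 s * U'ᴴ) * U := by rw [hXH]
      _ = (V'ᴴ * V') * rdiag 𝕜 s * W := by simp only [hW, Matrix.mul_assoc]
      _ = rdiag 𝕜 s * W := by rw [hV', Matrix.one_mul]
  have hf' : W * rdiag 𝕜 (f s) = rdiag 𝕜 (f s) * Z := by
    ext i j
    have e1 := congrFun (congrFun hc i) j
    have e2 := congrFun (congrFun hc' i) j
    simp only [rdiag, Matrix.mul_diagonal, Matrix.diagonal_mul] at e1 e2 ⊢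
    by_cases hij : s i = s j
    · rw [hf.eq_of_eq hij]
      by_cases h0 : s j = 0
      · simp [hf.eq_zero h0]
      · have h0' : (s j : 𝕜) ≠ 0 := by exact_mod_cast h0
        rw [hij, mul_comm] at e1
        rw [mul_left_cancel₀ h0' e1, mul_comm]
    · have hne : ((s i : 𝕜) ^ 2 - (s j : 𝕜) ^ 2) ≠ 0 := by
        intro h0
        have : s i ^ 2 = s j ^ 2 := by exact_mod_cast sub_eq_zero.1 h0
        exact hij ((sq_eq_sq₀ (h.nonneg i) (h.nonneg j)).1 this)
      have hW0 : W i j = 0 := by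
        refine (mul_eq_zero.1 (?_ : ((s i : 𝕜) ^ 2 - (s j : 𝕜) ^ 2) * W i j = 0)).resolve_left hne
        linear_combination (-(s j : 𝕜)) * e1 - (s i : 𝕜) * e2
      have hZ0 : Z i j = 0 := by
        refine (mul_eq_zero.1 (?_ : ((s i : 𝕜) ^ 2 - (s j : 𝕜) ^ 2) * Z i j = 0)).resolve_left hne
        linear_combination (-(s i : 𝕜)) * e1 - (s j : 𝕜) * e2
      simp [hW0, hZ0]
  calc U' * rdiag 𝕜 (f s) * V'ᴴ = U' * (rdiag 𝕜 (f s) * Z) * Vᴴ := by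
        simp only [hZ, Matrix.mul_assoc, hV2, Matrix.mul_one]
    _ = (U' * U'ᴴ) * U * rdiag 𝕜 (f s) * Vᴴ := by rw [← hf', hW]; simp only [Matrix.mul_assoc]
    _ = U * rdiag 𝕜 (f s) * Vᴴ := by rw [hU2', Matrix.one_mul]

/-- Every Hermitian matrix has a singular value decomposition. -/
theorem exists_isSVD {X : Matrix (Fin n) (Fin n) 𝕜} (hX : X.IsHermitian) :
    ∃ U V : Matrix (Fin n) (Fin n) 𝕜, ∃ s, IsSVD X U V s := by
  classical
  let P : Matrix (Fin n) (Fin n) 𝕜 := hX.eigenvectorUnitary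
  let l := hX.eigenvalues
  have hP : P * Pᴴ = 1 := Matrix.mem_unitaryGroup_iff.1 hX.eigenvectorUnitary.2
  have hPX : X = P * rdiag 𝕜 l * Pᴴ := by
    simpa [Unitary.conjStarAlgAut_apply, Matrix.star_eq_conjTranspose, rdiag, Function.comp_def]
      using hX.spectral_theorem
  let τ := Tuple.sort fun i => -|l i|
  have hτ : Monotone ((fun i => -|l i|) ∘ τ) := Tuple.monotone_sort _
  let s : Fin n → ℝ := fun i => |l (τ i)|
  let e : Fin n → 𝕜 := fun i => if 0 ≤ l i then 1 else -1
  have hee : ∀ i, e i * star (e i) = 1 := fun i => by by_cases h : 0 ≤ l i <;> simp [e, h]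
  have hse : ∀ i, ((|l i| : ℝ) : 𝕜) * star (e i) = (l i : 𝕜) := fun i => by
    by_cases h : 0 ≤ l i
    · simp [e, h, abs_of_nonneg h]
    · simp [e, h, abs_of_neg (not_le.1 h)]
  refine ⟨P.submatrix id τ, (P * Matrix.diagonal e).submatrix id τ, s, ?_, ?_, ?_, ?_, ?_⟩
  · rw [Matrix.mem_unitaryGroup_iff, Matrix.star_eq_conjTranspose, Matrix.conjTranspose_submatrix,
      Matrix.submatrix_mul_equiv, hP, Matrix.submatrix_id_id]
  · rw [Matrix.mem_unitaryGroup_iff, Matrix.star_eq_conjTranspose, Matrix.conjTranspose_submatrix,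
      Matrix.submatrix_mul_equiv, Matrix.conjTranspose_mul, Matrix.diagonal_conjTranspose,
      Matrix.mul_assoc, ← Matrix.mul_assoc (Matrix.diagonal e), Matrix.diagonal_mul_diagonal]
    simp only [Pi.star_apply, hee, Matrix.diagonal_one, Matrix.one_mul, hP,
      Matrix.submatrix_id_id]
  · intro i j hij
    have := hτ hij
    simp only [Function.comp_apply] at this
    exact neg_le_neg_iff.1 this
  · exact fun i => abs_nonneg _
  · have hs : rdiag 𝕜 s = (rdiag 𝕜 fun i => |l i|).submatrix τ τ := by
      ext i j
      simp [rdiag, s, Matrix.diagonal_apply]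
    rw [hs, Matrix.conjTranspose_submatrix, Matrix.submatrix_mul_equiv,
      Matrix.submatrix_mul_equiv, Matrix.submatrix_id_id, Matrix.conjTranspose_mul,
      Matrix.diagonal_conjTranspose, Matrix.mul_assoc, ← Matrix.mul_assoc (rdiag 𝕜 _), rdiag,
      Matrix.diagonal_mul_diagonal, ← Matrix.mul_assoc]
    simp only [Pi.star_apply, hse]
    exact hPX

end Spectral

/-! ### Hermitian matrices with the trace inner product -/

section Space

variable {n d : ℕ} {𝕜 : Type*} [RCLike 𝕜]

/-- The real trace inner product `⟨X, Y⟩ = Re Tr(Xᴴ Y)`. -/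
def trInner (X Y : Matrix (Fin n) (Fin n) 𝕜) : ℝ := RCLike.re (Xᴴ * Y).trace

/-- The Frobenius norm. -/
def frobNorm (X : Matrix (Fin n) (Fin n) 𝕜) : ℝ := Real.sqrt (trInner X X)

/-- `Θ₁, …, Θ_d` is an orthonormal basis of the real inner product space of `n × n` Hermitian
matrices over `𝕜` (real symmetric matrices for `𝕜 = ℝ`). -/
structure IsHermitianONB (Θ : Fin d → Matrix (Fin n) (Fin n) 𝕜) : Prop where
  isHermitian : ∀ k, (Θ k).IsHermitian
  orthonormal : ∀ j k, trInner (Θ j) (Θ k) = if j = k then 1 else 0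
  span : ∀ X : Matrix (Fin n) (Fin n) 𝕜, X.IsHermitian → X ∈ Submodule.span ℝ (Set.range Θ)

/-- The operator `Q_β† (X) = ∑_{k ∈ β} (1 / p_k) ⟨Θ_k, X⟩ Θ_k`. -/
def Qdag (Θ : Fin d → Matrix (Fin n) (Fin n) 𝕜) (p : Fin d → ℝ) (β : Finset (Fin d))
    (X : Matrix (Fin n) (Fin n) 𝕜) : Matrix (Fin n) (Fin n) 𝕜 :=
  ∑ k ∈ β, (1 / p k * trInner (Θ k) X) • Θ k

/-- `X = P Diag(l) Pᴴ` is an eigenvalue decomposition: `P` is unitary (orthogonal for `𝕜 = ℝ`) and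
the eigenvalues are arranged so that `|l₁| ≥ … ≥ |l_n|`. -/
structure IsEigenDecomp (X P : Matrix (Fin n) (Fin n) 𝕜) (l : Fin n → ℝ) : Prop where
  unitary : P ∈ Matrix.unitaryGroup (Fin n) 𝕜
  antitone_abs : Antitone fun i => |l i|
  eq : X = P * rdiag 𝕜 l * Pᴴ

/-- The last `n - r` columns of `P`. -/
def lastCols (P : Matrix (Fin n) (Fin n) 𝕜) (r : ℕ) : Matrix (Fin n) (Fin (n - r)) 𝕜 :=
  Matrix.of fun i j => P i ⟨r + j, by have := j.isLt; omega⟩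

end Space

/-! ### Observations and the rank-correction step -/

section Estimator

variable {n d : ℕ} {𝕜 : Type*} [RCLike 𝕜] {Ω : Type*} [MeasurableSpace Ω]

/-- The sampled indices `idx 0, idx 1, …` are i.i.d. with `Pr(idx i = k) = p k`; the noises
`ξ 0, ξ 1, …` are i.i.d. with mean zero and unit second moment; the noises are independent of the
sampled indices. -/
structure IsSampling (μ : Measure Ω) (p : Fin d → ℝ) (idx : ℕ → Ω → Fin d) (ξ : ℕ → Ω → ℝ) :
    Prop where
  measurable_idx : ∀ i, Measurable (idx i)
  law_idx : ∀ i k, μ {w | idx i w = k} = ENNReal.ofReal (p k)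
  indep_idx : iIndepFun idx μ
  measurable_noise : ∀ i, Measurable (ξ i)
  identDistrib_noise : ∀ i, IdentDistrib (ξ i) (ξ 0) μ μ
  indep_noise : iIndepFun ξ μ
  memLp_noise : MemLp (ξ 0) 2 μ
  mean_noise : ∫ w, ξ 0 w ∂μ = 0
  second_moment_noise : ∫ w, ξ 0 w ^ 2 ∂μ = 1
  indep_noise_idx : IndepFun (fun w i => ξ i w) (fun w i => idx i w) μ

/-- The `i`-th observation `y_i = ⟨Θ_{idx i}, X̄⟩ + ν ξ_i`. -/
def observation (Θ : Fin d → Matrix (Fin n) (Fin n) 𝕜) (Xbar : Matrix (Fin n) (Fin n) 𝕜) (ν : ℝ)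
    (idx : ℕ → Fin d) (ξ : ℕ → ℝ) (i : ℕ) : ℝ :=
  trInner (Θ (idx i)) Xbar + ν * ξ i

/-- The objective function of the positive semidefinite rank-correction step with `m` observations
`y 0, …, y (m - 1)` at the indices `idx 0, …, idx (m - 1)`, spectral operator associated with `f`
and initial estimator `Xini`. -/
def rcsObjective (Θ : Fin d → Matrix (Fin n) (Fin n) 𝕜) (f : (Fin n → ℝ) → (Fin n → ℝ)) (m : ℕ)
    (idx : ℕ → Fin d) (y : ℕ → ℝ) (ρ γ : ℝ) (Xini X : Matrix (Fin n) (Fin n) 𝕜) : ℝ :=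
  1 / (2 * m) * ∑ i ∈ Finset.range m, (y i - trInner (Θ (idx i)) X) ^ 2
    + ρ * (trInner (1 - spectralOperator f Xini) X + γ / 2 * frobNorm (X - Xini) ^ 2)

/-- The feasible set: `X` is positive semidefinite and has the same basis coefficients as `X̄` with
respect to `Θ_k`, `k ∈ α`. -/
def rcsFeasible (Θ : Fin d → Matrix (Fin n) (Fin n) 𝕜) (α : Finset (Fin d))
    (Xbar : Matrix (Fin n) (Fin n) 𝕜) : Set (Matrix (Fin n) (Fin n) 𝕜) :=
  {X | X.PosSemidef ∧ ∀ k ∈ α, trInner (Θ k) X = trInner (Θ k) Xbar}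

/-- `X` is an optimal solution of the positive semidefinite rank-correction step. -/
def IsRCSSolution (Θ : Fin d → Matrix (Fin n) (Fin n) 𝕜) (α : Finset (Fin d))
    (Xbar : Matrix (Fin n) (Fin n) 𝕜) (f : (Fin n → ℝ) → (Fin n → ℝ)) (m : ℕ)
    (idx : ℕ → Fin d) (y : ℕ → ℝ) (ρ γ : ℝ) (Xini X : Matrix (Fin n) (Fin n) 𝕜) : Prop :=
  X ∈ rcsFeasible Θ α Xbar ∧
    IsMinOn (rcsObjective Θ f m idx y ρ γ Xini) (rcsFeasible Θ α Xbar) X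

/-- A random matrix: all entries are measurable. -/
def IsRandomMatrix (X : Ω → Matrix (Fin n) (Fin n) 𝕜) : Prop :=
  ∀ i j, Measurable fun w => X w i j

/-- `X_m = O_p(1)`: for every `ε > 0` there is `M` with `Pr(|X_m| > M) ≤ ε` for all large `m`. -/
def BoundedInProbability (μ : Measure Ω) (X : ℕ → Ω → ℝ) : Prop :=
  ∀ ε : ENNReal, 0 < ε → ∃ M : ℝ, ∀ᶠ m in atTop, μ {w | M < |X m w|} ≤ ε

/-- Convergence in probability of random matrices to a constant matrix. -/
def TendstoInProbability (μ : Measure Ω) (X : ℕ → Ω → Matrix (Fin n) (Fin n) 𝕜)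
    (Xbar : Matrix (Fin n) (Fin n) 𝕜) : Prop :=
  TendstoInMeasure μ (fun m w => frobNorm (X m w - Xbar)) atTop fun _ => 0

/-- Rank consistency: `Pr(rank X_m = rank X̄) → 1`. -/
def RankConsistent (μ : Measure Ω) (X : ℕ → Ω → Matrix (Fin n) (Fin n) 𝕜)
    (Xbar : Matrix (Fin n) (Fin n) 𝕜) : Prop :=
  Tendsto (fun m => μ {w | (X m w).rank = Xbar.rank}) atTop (𝓝 1)

end Estimator

end RankCorrection

end

noncomputable section

namespace RankCorrection

/-! ### The trace inner product -/

section TraceInner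

variable {n k d : ℕ} {𝕜 : Type*} [RCLike 𝕜]

/-! The argument is primal-dual, on the scale `ρ`. In the coordinates of `Θ` the objective is a
separable quadratic, so optimality over the convex feasible set is a variational inequality with
gradient `ρ (a D + C)` on the free coordinates, where `D` is the error divided by `ρ`
(`IsRCSSolution.variationalInequality`). The law of large numbers gives `a → p`. A variance bound
together with `√m ρ → ∞` makes the noise in `C` negligible, and continuity of the spectral operator
then gives `C → I - F(X̄)`.

Testing with `X̄` bounds `D`. The Slater point supplies a positive semidefinite multiplier `S` with
`⟨S, X̂⟩ = 0` whose free coordinates are `a D + C` (`exists_multiplier`), and it also bounds `S`.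
Along an ultrafilter everything converges. The limit `S'` annihilates `X̄`, hence `S' = P₂ Λ P₂ᴴ`,
and monotonicity of the limiting system together with uniqueness of its positive definite solution
forces `Λ = Λ̂` (`eq_of_multiplierSystem`).

As `Λ̂` is nonsingular, `S` eventually has rank at least `n - r`. Since `S X̂ = 0`, the rank of `X̂`
is at most `r`, while lower semicontinuity of the rank gives at least `r`.

All of this is deterministic and valid along any filter
(`eventually_rank_eq_of_variationalInequality`). Probability enters only by choosing the filter of
events whose probability tends to one (`probFilter`). -/

theorem trInner_comm (X Y : Matrix (Fin n) (Fin n) 𝕜) : trInner X Y = trInner Y X := by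
  unfold trInner
  rw [← Matrix.conjTranspose_conjTranspose Y, ← Matrix.conjTranspose_mul,
    Matrix.trace_conjTranspose, Matrix.conjTranspose_conjTranspose, RCLike.star_def, RCLike.conj_re]

/-- The trace inner product as a real linear map in its second argument. -/
def trInnerLin (X : Matrix (Fin n) (Fin n) 𝕜) : Matrix (Fin n) (Fin n) 𝕜 →ₗ[ℝ] ℝ where
  toFun := trInner X
  map_add' Y Z := by simp [trInner, Matrix.mul_add]
  map_smul' c Y := by simp [trInner, RCLike.smul_re]

theorem trInner_add_right (X Y Z : Matrix (Fin n) (Fin n) 𝕜) :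
    trInner X (Y + Z) = trInner X Y + trInner X Z := (trInnerLin X).map_add Y Z

theorem trInner_zero_right (X : Matrix (Fin n) (Fin n) 𝕜) : trInner X 0 = 0 :=
  (trInnerLin X).map_zero

theorem trInner_sub_right (X Y Z : Matrix (Fin n) (Fin n) 𝕜) :
    trInner X (Y - Z) = trInner X Y - trInner X Z := (trInnerLin X).map_sub Y Z

theorem trInner_smul_right (c : ℝ) (X Y : Matrix (Fin n) (Fin n) 𝕜) :
    trInner X (c • Y) = c * trInner X Y := (trInnerLin X).map_smul c Y

theorem trInner_sum_right {ι : Type*} (s : Finset ι) (X : Matrix (Fin n) (Fin n) 𝕜)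
    (Y : ι → Matrix (Fin n) (Fin n) 𝕜) :
    trInner X (∑ i ∈ s, Y i) = ∑ i ∈ s, trInner X (Y i) := map_sum (trInnerLin X) Y s

theorem trInner_conj (M : Matrix (Fin k) (Fin k) 𝕜) (A : Matrix (Fin n) (Fin k) 𝕜)
    (X : Matrix (Fin n) (Fin n) 𝕜) : trInner (A * M * Aᴴ) X = trInner M (Aᴴ * X * A) := by
  simp only [trInner, Matrix.conjTranspose_mul, Matrix.conjTranspose_conjTranspose,
    Matrix.mul_assoc]
  rw [Matrix.trace_mul_comm]
  simp only [Matrix.mul_assoc]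

theorem continuous_trInner (X : Matrix (Fin n) (Fin n) 𝕜) : Continuous (trInner X) := by
  unfold trInner
  fun_prop

open scoped MatrixOrder in
theorem exists_eq_conjTranspose_mul_self {X : Matrix (Fin n) (Fin n) 𝕜} (hX : X.PosSemidef) :
    ∃ B : Matrix (Fin n) (Fin n) 𝕜, X = Bᴴ * B :=
  CStarAlgebra.nonneg_iff_eq_star_mul_self.mp hX.nonneg

theorem trInner_nonneg {X Y : Matrix (Fin n) (Fin n) 𝕜} (hX : X.PosSemidef) (hY : Y.PosSemidef) :
    0 ≤ trInner X Y := by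
  obtain ⟨B, rfl⟩ := exists_eq_conjTranspose_mul_self hX
  have h : trInner (Bᴴ * B) Y = RCLike.re (B * Y * Bᴴ).trace := by
    rw [trInner, Matrix.conjTranspose_mul, Matrix.conjTranspose_conjTranspose, Matrix.mul_assoc,
      Matrix.trace_mul_comm]
  rw [h]
  exact (RCLike.nonneg_iff.1 (hY.mul_mul_conjTranspose_same B).trace_nonneg).1

/-- With `X = Bᴴ B` and `Y = Cᴴ C`, the inner product is the trace of the positive semidefinite
matrix `B Cᴴ C Bᴴ`. If that trace vanishes, so does `C Bᴴ`, and with it the product. -/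
theorem mul_eq_zero_of_trInner_eq_zero {X Y : Matrix (Fin n) (Fin n) 𝕜} (hX : X.PosSemidef)
    (hY : Y.PosSemidef) (h : trInner X Y = 0) : X * Y = 0 := by
  obtain ⟨B, rfl⟩ := exists_eq_conjTranspose_mul_self hX
  obtain ⟨C, rfl⟩ := exists_eq_conjTranspose_mul_self hY
  have h1 : RCLike.re (B * (Cᴴ * C) * Bᴴ).trace = 0 := by
    rw [← h, trInner, Matrix.conjTranspose_mul, Matrix.conjTranspose_conjTranspose,
      Matrix.mul_assoc Bᴴ B, Matrix.trace_mul_comm Bᴴ]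
  have hpsd : (B * (Cᴴ * C) * Bᴴ).PosSemidef := hY.mul_mul_conjTranspose_same B
  have h2 : (B * (Cᴴ * C) * Bᴴ).trace = 0 := by
    have := RCLike.nonneg_iff.1 hpsd.trace_nonneg
    exact RCLike.ext (by simpa using h1) (by simpa using this.2)
  have h3 : (C * Bᴴ)ᴴ * (C * Bᴴ) = 0 := by
    rw [hpsd.trace_eq_zero_iff] at h2
    rw [← h2]
    simp only [Matrix.conjTranspose_mul, Matrix.conjTranspose_conjTranspose, Matrix.mul_assoc]
  rw [Matrix.conjTranspose_mul_self_eq_zero] at h3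
  have h4 := congrArg Matrix.conjTranspose h3
  simp only [Matrix.conjTranspose_mul, Matrix.conjTranspose_conjTranspose,
    Matrix.conjTranspose_zero] at h4
  rw [Matrix.mul_assoc, ← Matrix.mul_assoc B, h4, Matrix.zero_mul, Matrix.mul_zero]

/-- One half of the self-duality of the cone. The rank-one matrices `v vᴴ` suffice as tests, since
they recover the quadratic form. -/
theorem posSemidef_of_trInner_nonneg {X : Matrix (Fin n) (Fin n) 𝕜} (hX : X.IsHermitian)
    (h : ∀ Y : Matrix (Fin n) (Fin n) 𝕜, Y.PosSemidef → 0 ≤ trInner X Y) : X.PosSemidef := by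
  rw [Matrix.posSemidef_iff_dotProduct_mulVec]
  refine ⟨hX, fun v => ?_⟩
  have h1 := h _ (Matrix.posSemidef_vecMulVec_self_star v)
  have h2 : (Xᴴ * Matrix.vecMulVec v (star v)).trace = star v ⬝ᵥ X *ᵥ v := by
    rw [hX.eq, Matrix.mul_vecMulVec, Matrix.trace_vecMulVec, dotProduct_comm]
  rw [trInner, h2] at h1
  refine RCLike.nonneg_iff.2 ⟨h1, ?_⟩
  exact hX.im_star_dotProduct_mulVec_self v

theorem isClosed_posSemidef : IsClosed {X : Matrix (Fin n) (Fin n) 𝕜 | X.PosSemidef} := by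
  simp only [Matrix.posSemidef_iff_dotProduct_mulVec, Set.ofPred_and, Set.ofPred_forall]
  refine IsClosed.inter (isClosed_eq (by fun_prop) continuous_id) (isClosed_iInter fun v => ?_)
  exact isClosed_le continuous_const (by fun_prop)

theorem posSemidef_add_smul_one {X : Matrix (Fin n) (Fin n) 𝕜} (hX : X.IsHermitian) {c : ℝ}
    (hc : ∀ i, 0 ≤ hX.eigenvalues i + c) : (X + c • (1 : Matrix (Fin n) (Fin n) 𝕜)).PosSemidef := by
  let P : Matrix (Fin n) (Fin n) 𝕜 := hX.eigenvectorUnitary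
  have hP : P * Pᴴ = 1 := Matrix.mem_unitaryGroup_iff.1 hX.eigenvectorUnitary.2
  have hPX : X = P * rdiag 𝕜 hX.eigenvalues * Pᴴ := by
    simpa [Unitary.conjStarAlgAut_apply, Matrix.star_eq_conjTranspose, rdiag, Function.comp_def]
      using hX.spectral_theorem
  have h : X + c • (1 : Matrix (Fin n) (Fin n) 𝕜)
      = P * rdiag 𝕜 (fun i => hX.eigenvalues i + c) * Pᴴ := by
    have e : rdiag 𝕜 (fun i => hX.eigenvalues i + c)
        = rdiag 𝕜 hX.eigenvalues + c • (1 : Matrix (Fin n) (Fin n) 𝕜) := by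
      ext i j
      by_cases hij : i = j
      · subst hij; simp [rdiag, RCLike.real_smul_eq_coe_mul]
      · simp [rdiag, hij]
    rw [e, Matrix.mul_add, Matrix.add_mul, ← hPX, Matrix.mul_smul, Matrix.smul_mul, Matrix.mul_one,
      hP]
  rw [h]
  refine Matrix.PosSemidef.mul_mul_conjTranspose_same (Matrix.PosSemidef.diagonal fun i => ?_) P
  rw [Pi.zero_apply]
  exact_mod_cast hc i

/-- Positive definite matrices are order units: `X` dominates a positive multiple `c` of the
identity, and `Y` is bounded below by a multiple `-K`, so `t = K / c` works. -/
theorem exists_smul_add_posSemidef {X Y : Matrix (Fin n) (Fin n) 𝕜} (hX : X.PosDef)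
    (hY : Y.IsHermitian) : ∃ t : ℝ, (t • X + Y).PosSemidef := by
  obtain ⟨c, hc0, hc⟩ : ∃ c : ℝ, 0 < c ∧ ∀ i, c ≤ hX.1.eigenvalues i := by
    rcases isEmpty_or_nonempty (Fin n) with h | h
    · exact ⟨1, one_pos, fun i => isEmptyElim i⟩
    · exact ⟨Finset.univ.inf' Finset.univ_nonempty hX.1.eigenvalues,
        (Finset.lt_inf'_iff _).2 fun i _ => hX.eigenvalues_pos i,
        fun i => Finset.inf'_le _ (Finset.mem_univ i)⟩
  have h1 := posSemidef_add_smul_one hX.1 (c := -c) fun i => by linarith [hc i]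
  have h2 := posSemidef_add_smul_one hY (c := ∑ i, |hY.eigenvalues i|) fun i => by
    have := Finset.single_le_sum (fun j _ => abs_nonneg (hY.eigenvalues j)) (Finset.mem_univ i)
    linarith [neg_abs_le (hY.eigenvalues i)]
  set K := ∑ i, |hY.eigenvalues i|
  have hK : 0 ≤ K / c := div_nonneg (Finset.sum_nonneg fun i _ => abs_nonneg _) hc0.le
  refine ⟨K / c, ?_⟩
  have h3 := (h1.smul hK).add h2
  convert h3 using 1
  rw [smul_add, smul_smul, mul_neg, div_mul_cancel₀ _ hc0.ne', neg_smul]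
  abel

/-! ### Coordinates with respect to an orthonormal basis -/

/-- The matrix with coordinates `x` with respect to `Θ`. -/
def synth (Θ : Fin d → Matrix (Fin n) (Fin n) 𝕜) : (Fin d → ℝ) →ₗ[ℝ] Matrix (Fin n) (Fin n) 𝕜 :=
  Fintype.linearCombination ℝ Θ

theorem synth_apply (Θ : Fin d → Matrix (Fin n) (Fin n) 𝕜) (x : Fin d → ℝ) :
    synth Θ x = ∑ k, x k • Θ k := rfl

theorem continuous_synth (Θ : Fin d → Matrix (Fin n) (Fin n) 𝕜) : Continuous (synth Θ) := by
  simp only [funext (synth_apply Θ)]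
  fun_prop

variable {Θ : Fin d → Matrix (Fin n) (Fin n) 𝕜}

theorem isHermitian_sum_smul (hΘ : IsHermitianONB Θ) (s : Finset (Fin d)) (x : Fin d → ℝ) :
    (∑ k ∈ s, x k • Θ k).IsHermitian := by
  rw [Matrix.IsHermitian, Matrix.conjTranspose_sum]
  exact Finset.sum_congr rfl fun k _ => by rw [Matrix.conjTranspose_smul, (hΘ.1 k).eq, star_trivial]

theorem isHermitian_synth (hΘ : IsHermitianONB Θ) (x : Fin d → ℝ) : (synth Θ x).IsHermitian := by
  rw [synth_apply]
  exact isHermitian_sum_smul hΘ _ x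

theorem trInner_synth (hΘ : IsHermitianONB Θ) (x : Fin d → ℝ) (k : Fin d) :
    trInner (Θ k) (synth Θ x) = x k := by
  rw [synth_apply, trInner_sum_right]
  simp [trInner_smul_right, hΘ.orthonormal]

theorem synth_trInner (hΘ : IsHermitianONB Θ) {X : Matrix (Fin n) (Fin n) 𝕜} (hX : X.IsHermitian) :
    synth Θ (fun k => trInner (Θ k) X) = X := by
  obtain ⟨x, rfl⟩ : ∃ x, synth Θ x = X := by
    have := hΘ.span X hX
    rwa [← Fintype.range_linearCombination ℝ] at this
  simp only [trInner_synth hΘ]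

theorem trInner_synth_right (Θ : Fin d → Matrix (Fin n) (Fin n) 𝕜) (x : Fin d → ℝ)
    (X : Matrix (Fin n) (Fin n) 𝕜) : trInner X (synth Θ x) = ∑ k, x k * trInner (Θ k) X := by
  rw [synth_apply, trInner_sum_right]
  exact Finset.sum_congr rfl fun k _ => by rw [trInner_smul_right, trInner_comm]

theorem trInner_eq_sum (hΘ : IsHermitianONB Θ) (X : Matrix (Fin n) (Fin n) 𝕜)
    {Y : Matrix (Fin n) (Fin n) 𝕜} (hY : Y.IsHermitian) :
    trInner X Y = ∑ k, trInner (Θ k) X * trInner (Θ k) Y := by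
  conv_lhs => rw [← synth_trInner hΘ hY, trInner_synth_right]
  exact Finset.sum_congr rfl fun k _ => mul_comm _ _

/-! ### Lower semicontinuity of the rank -/

/-- A nonsingular `k × k` compression stays nonsingular under small perturbations, and its size
bounds the rank from below. -/
theorem eventually_le_rank {ι : Type*} {L : Filter ι} {X : ι → Matrix (Fin n) (Fin n) 𝕜}
    {X₀ : Matrix (Fin n) (Fin n) 𝕜} (h : Tendsto X L (𝓝 X₀)) (A : Matrix (Fin n) (Fin k) 𝕜)
    (hA : (Aᴴ * X₀ * A).det ≠ 0) : ∀ᶠ i in L, k ≤ (X i).rank := by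
  have hc : Continuous fun Y : Matrix (Fin n) (Fin n) 𝕜 => (Aᴴ * Y * A).det := by fun_prop
  filter_upwards [((hc.tendsto X₀).comp h).eventually_ne hA] with i hi
  have h1 : (Aᴴ * X i * A).rank = k := by
    rw [Matrix.rank_of_isUnit _ ((Matrix.isUnit_iff_isUnit_det _).2 (isUnit_iff_ne_zero.2 hi)),
      Fintype.card_fin]
  calc k = (Aᴴ * X i * A).rank := h1.symm
    _ ≤ (Aᴴ * X i).rank := Matrix.rank_mul_le_left _ _
    _ ≤ (X i).rank := Matrix.rank_mul_le_right _ _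

end TraceInner

/-! ### Lagrange multipliers -/

section Multiplier

variable {n d : ℕ} {𝕜 : Type*} [RCLike 𝕜] {Θ : Fin d → Matrix (Fin n) (Fin n) 𝕜}

/-- The cone of coordinate vectors of positive semidefinite matrices. -/
def psdCone (Θ : Fin d → Matrix (Fin n) (Fin n) 𝕜) : PointedCone ℝ (Fin d → ℝ) where
  carrier := {x | (synth Θ x).PosSemidef}
  add_mem' {x y} hx hy := by
    simp only [Set.mem_ofPred_eq, map_add] at hx hy ⊢
    exact hx.add hy
  zero_mem' := by simpa using Matrix.PosSemidef.zero
  smul_mem' c x hx := by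
    simp only [Set.mem_ofPred_eq] at hx ⊢
    have h : c • x = (c : ℝ) • x := rfl
    rw [h, map_smul]
    exact hx.smul c.2

theorem mem_psdCone {x : Fin d → ℝ} : x ∈ psdCone Θ ↔ (synth Θ x).PosSemidef := Iff.rfl

/-- Coordinate vectors vanishing on `α`. -/
def vanishingOn (α : Finset (Fin d)) : Submodule ℝ (Fin d → ℝ) where
  carrier := {x | ∀ k ∈ α, x k = 0}
  add_mem' {x y} hx hy k hk := by simp [hx k hk, hy k hk]
  zero_mem' k _ := rfl
  smul_mem' c x hx k hk := by simp [hx k hk]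

/-- Conic duality. The functional given by `G` on directions vanishing on `α`, extended to vanish at
`X`, is nonnegative on the part of the cone lying in its domain. The Slater point makes it
extendable to a functional nonnegative on the whole cone, and self-duality turns that functional
into `S`. -/
theorem exists_multiplier (hΘ : IsHermitianONB Θ) {α : Finset (Fin d)}
    {X X₀ : Matrix (Fin n) (Fin n) 𝕜} (hX : X.PosSemidef) (hX₀ : X₀.PosDef)
    (hXX₀ : ∀ k ∈ α, trInner (Θ k) X₀ = trInner (Θ k) X) {G : Fin d → ℝ}
    (hG : ∀ Y ∈ rcsFeasible Θ α X,
      0 ≤ ∑ k ∈ αᶜ, G k * (trInner (Θ k) Y - trInner (Θ k) X)) :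
    ∃ S : Matrix (Fin n) (Fin n) 𝕜, S.PosSemidef ∧ trInner S X = 0 ∧
      ∀ k ∈ αᶜ, trInner (Θ k) S = G k := by
  classical
  set x : Fin d → ℝ := fun k => trInner (Θ k) X with hx
  have hxX : synth Θ x = X := synth_trInner hΘ hX.1
  -- The coordinates of `G` on `α` are free. They are taken proportional to `x`, with the factor
  -- that gives `φ x = 0`.
  set c : ℝ := (∑ k ∈ αᶜ, G k * x k) / ∑ k ∈ α, x k ^ 2 with hc
  let G' : Fin d → ℝ := fun k => if k ∈ α then -c * x k else G k
  let φ : (Fin d → ℝ) →ₗ[ℝ] ℝ := Fintype.linearCombination ℝ G'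
  have hφ : ∀ y, φ y = ∑ k, y k * G' k := fun y => by
    simp [φ, Fintype.linearCombination_apply]
  have hφV : ∀ h ∈ vanishingOn α, φ h = ∑ k ∈ αᶜ, G k * h k := by
    intro h hh
    rw [hφ, ← Finset.sum_compl_add_sum α, Finset.sum_eq_zero (s := α), add_zero]
    · refine Finset.sum_congr rfl fun k hk => ?_
      simp only [G', if_neg (Finset.mem_compl.1 hk), mul_comm]
    · intro k hk
      rw [hh k hk, zero_mul]
  have hφx : φ x = 0 := by
    have e : φ x = ∑ k ∈ αᶜ, G k * x k - c * ∑ k ∈ α, x k ^ 2 := by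
      rw [hφ, ← Finset.sum_compl_add_sum α, Finset.mul_sum, sub_eq_add_neg,
        ← Finset.sum_neg_distrib]
      congr 1
      · refine Finset.sum_congr rfl fun k hk => ?_
        simp only [G', if_neg (Finset.mem_compl.1 hk), mul_comm]
      · refine Finset.sum_congr rfl fun k hk => ?_
        simp only [G', if_pos hk]
        ring
    by_cases h0 : ∑ k ∈ α, x k ^ 2 = 0
    -- If `X` vanishes on `α`, no such factor is available, but the constraints are homogeneous.
    -- Both `0` and `2X` are then feasible, and testing with them gives `φ x = 0`.
    · have hxα : ∀ k ∈ α, x k = 0 := fun k hk =>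
        pow_eq_zero_iff two_ne_zero |>.1 ((Finset.sum_eq_zero_iff_of_nonneg
          (fun k _ => sq_nonneg (x k))).1 h0 k hk)
      have h1 := hG 0 ⟨Matrix.PosSemidef.zero, fun k hk => by
        rw [trInner_zero_right]
        exact (hxα k hk).symm⟩
      have h2 := hG (X + X) ⟨hX.add hX, fun k hk => by
        rw [trInner_add_right]
        have : trInner (Θ k) X = 0 := hxα k hk
        rw [this, add_zero]⟩
      simp only [trInner_add_right, add_sub_cancel_right] at h2
      simp only [trInner_zero_right, zero_sub, mul_neg, Finset.sum_neg_distrib] at h1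
      rw [e, h0, mul_zero, sub_zero]
      exact le_antisymm (by linarith) h2
    · rw [e, hc, div_mul_cancel₀ _ h0, sub_self]
  let p : Submodule ℝ (Fin d → ℝ) := vanishingOn α ⊔ Submodule.span ℝ {x}
  obtain ⟨g, hg, hgs⟩ := riesz_extension (psdCone Θ) ⟨p, φ.domRestrict p⟩
    (by
      rintro ⟨y, hy⟩ hys
      change 0 ≤ φ y
      obtain ⟨h, hh, z, hz, rfl⟩ := Submodule.mem_sup.1 hy
      obtain ⟨t, rfl⟩ := Submodule.mem_span_singleton.1 hz
      have hys' : (synth Θ (h + t • x)).PosSemidef := hys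
      -- The step is so short that `x + ε h` is a nonnegative combination of `x` and `h + t x`,
      -- hence feasible.
      set ε : ℝ := 1 / (1 + |t|) with hε
      have hε0 : 0 < ε := by positivity
      have hεt : 0 ≤ 1 - ε * t := by
        have : ε * t ≤ 1 := by
          rw [hε, one_div, inv_mul_le_iff₀ (by positivity)]
          linarith [le_abs_self t]
        linarith
      have hpsd : (synth Θ (x + ε • h)).PosSemidef := by
        have : x + ε • h = (1 - ε * t) • x + ε • (h + t • x) := by
          rw [smul_add, smul_smul, sub_smul, one_smul]; abel
        rw [this, map_add, map_smul, map_smul, hxX]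
        exact (hX.smul hεt).add (hys'.smul hε0.le)
      have h1 := hG _ ⟨hpsd, fun k hk => by
        rw [trInner_synth hΘ, Pi.add_apply, Pi.smul_apply, hh k hk, smul_zero, add_zero]⟩
      have h2 : ∑ k ∈ αᶜ, G k * (trInner (Θ k) (synth Θ (x + ε • h)) - trInner (Θ k) X)
          = ε * ∑ k ∈ αᶜ, G k * h k := by
        rw [Finset.mul_sum]
        refine Finset.sum_congr rfl fun k _ => ?_
        rw [trInner_synth hΘ, Pi.add_apply, Pi.smul_apply, smul_eq_mul, hx]
        ring
      rw [h2] at h1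
      rw [map_add, map_smul, hφx, smul_zero, add_zero, hφV h hh]
      exact nonneg_of_mul_nonneg_right h1 hε0)
    (by
      -- The cofinality hypothesis of the extension theorem: the Slater point lies in `p` and is an
      -- order unit.
      intro y
      obtain ⟨t, ht⟩ := exists_smul_add_posSemidef hX₀ (isHermitian_synth hΘ y)
      set x₀ : Fin d → ℝ := fun k => trInner (Θ k) X₀ with hx₀
      have hx₀p : x₀ ∈ p := Submodule.mem_sup.2 ⟨x₀ - x, fun k hk => by
        rw [Pi.sub_apply, hx₀, hx]
        exact sub_eq_zero.2 (hXX₀ k hk), x, Submodule.mem_span_singleton_self x,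
        sub_add_cancel _ _⟩
      refine ⟨⟨t • x₀, p.smul_mem t hx₀p⟩, ?_⟩
      rw [mem_psdCone]
      change (synth Θ (t • x₀ + y)).PosSemidef
      rwa [map_add, map_smul, hx₀, synth_trInner hΘ hX₀.1])
  have hgp : ∀ y ∈ p, g y = φ y := fun y hy => hg ⟨y, hy⟩
  set s : Fin d → ℝ := fun k => g (Pi.single k 1) with hs
  have hgsum : ∀ y, g y = ∑ k, y k * s k := fun y => by
    conv_lhs => rw [pi_eq_sum_univ' y]
    simp [hs, map_sum]
  have htr : ∀ Y : Matrix (Fin n) (Fin n) 𝕜, Y.IsHermitian →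
      trInner (synth Θ s) Y = g fun k => trInner (Θ k) Y := fun Y hY => by
    rw [trInner_eq_sum hΘ _ hY, hgsum]
    exact Finset.sum_congr rfl fun k _ => by rw [trInner_synth hΘ, mul_comm]
  refine ⟨synth Θ s, ?_, ?_, ?_⟩
  · refine posSemidef_of_trInner_nonneg (isHermitian_synth hΘ s) fun Y hY => ?_
    rw [htr Y hY.1]
    exact hgs _ (mem_psdCone.2 (by rwa [synth_trInner hΘ hY.1]))
  · rw [htr X hX.1]
    exact (hgp x (Submodule.mem_sup_right (Submodule.mem_span_singleton_self x))).trans hφx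
  · intro k hk
    have hmem : Pi.single k 1 ∈ vanishingOn α := fun j hj => by
      have : j ≠ k := fun h => Finset.mem_compl.1 hk (h ▸ hj)
      simp [this]
    rw [trInner_synth hΘ]
    simp only [hs]
    rw [hgp _ (Submodule.mem_sup_left hmem), hφV _ hmem,
      Finset.sum_eq_single_of_mem k hk]
    · simp
    · intro j _ hjk
      simp [hjk]

end Multiplier

/-! ### The kernel of the target matrix -/

section Kernel

variable {n : ℕ} {𝕜 : Type*} [RCLike 𝕜] {X P : Matrix (Fin n) (Fin n) 𝕜} {l : Fin n → ℝ}

/-- The ordering by absolute value puts the nonzero eigenvalues first, and the rank counts them.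
Indices start at `0`, so the zero eigenvalues begin exactly at index `X.rank`. -/
theorem IsEigenDecomp.eigenvalue_eq_zero_iff (h : IsEigenDecomp X P l) (i : Fin n) :
    l i = 0 ↔ X.rank ≤ i := by
  classical
  have hPu : IsUnit P := (Unitary.toUnits ⟨P, h.unitary⟩).isUnit
  have hPu' : IsUnit Pᴴ := by
    have := (Unitary.toUnits (star ⟨P, h.unitary⟩ : Matrix.unitaryGroup (Fin n) 𝕜)).isUnit
    exact this
  have hrank : X.rank = (Finset.univ.filter fun i => l i ≠ 0).card := by
    rw [h.eq, Matrix.rank_mul_eq_left_of_isUnit_det _ _ ((Matrix.isUnit_iff_isUnit_det _).1 hPu'),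
      Matrix.rank_mul_eq_right_of_isUnit_det _ _ ((Matrix.isUnit_iff_isUnit_det _).1 hPu), rdiag,
      Matrix.rank_diagonal, Fintype.card_subtype]
    simp
  have hmono : ∀ i j : Fin n, i ≤ j → l i = 0 → l j = 0 := fun i j hij hi => by
    have := h.antitone_abs hij
    simp only [hi, abs_zero] at this
    exact abs_nonpos_iff.1 this
  constructor
  · intro hi
    rw [hrank, ← Fin.card_Iio i]
    refine Finset.card_le_card fun j hj => ?_
    rw [Finset.mem_Iio]
    by_contra hij
    exact (Finset.mem_filter.1 hj).2 (hmono i j (not_lt.1 hij) hi)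
  · intro hi
    by_contra h0
    have : (Finset.Iic i).card ≤ X.rank := by
      rw [hrank]
      refine Finset.card_le_card fun j hj => ?_
      rw [Finset.mem_filter]
      exact ⟨Finset.mem_univ _, fun hj0 => h0 (hmono j i (Finset.mem_Iic.1 hj) hj0)⟩
    rw [Fin.card_Iic] at this
    omega

theorem lastCols_mul_conjTranspose (P : Matrix (Fin n) (Fin n) 𝕜) (r : ℕ) :
    lastCols P r * (lastCols P r)ᴴ
      = P * Matrix.diagonal (fun i : Fin n => if r ≤ (i : ℕ) then (1 : 𝕜) else 0) * Pᴴ := by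
  ext a b
  rw [Matrix.mul_apply, Matrix.mul_apply]
  simp only [Matrix.mul_diagonal, lastCols, Matrix.of_apply,
    Matrix.conjTranspose_apply, mul_ite, mul_one, mul_zero, ite_mul, zero_mul]
  rw [← Finset.sum_filter]
  refine Finset.sum_bij (fun j _ => ⟨r + j, by have := j.isLt; omega⟩) ?_ ?_ ?_ ?_
  · intro j _
    simp
  · intro i _ j _ hij
    simpa [Fin.ext_iff] using hij
  · intro b hb
    have hb' : r ≤ (b : ℕ) := (Finset.mem_filter.1 hb).2
    exact ⟨⟨b - r, by have := b.isLt; omega⟩, Finset.mem_univ _, by ext; simp; omega⟩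
  · intro j _
    rfl

theorem IsEigenDecomp.mul_lastCols (h : IsEigenDecomp X P l) : X * lastCols P X.rank = 0 := by
  have hP : Pᴴ * P = 1 := Matrix.mem_unitaryGroup_iff'.1 h.unitary
  have h1 : X * P = P * rdiag 𝕜 l := by
    conv_lhs => rw [h.eq, Matrix.mul_assoc, hP, Matrix.mul_one]
  ext i j
  have h2 := congrFun (congrFun h1 i) ⟨X.rank + j, by have := j.isLt; omega⟩
  rw [rdiag, Matrix.mul_diagonal, (h.eigenvalue_eq_zero_iff _).2 (Nat.le_add_right _ _)] at h2
  simpa [Matrix.mul_apply, lastCols] using h2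

/-- `S` vanishes on the range of `X`, so it is unchanged when multiplied on either side by the
orthogonal projection `P₂ P₂ᴴ` onto the kernel. -/
theorem IsEigenDecomp.eq_conj_of_mul_eq_zero (h : IsEigenDecomp X P l)
    {S : Matrix (Fin n) (Fin n) 𝕜} (hS : S.IsHermitian) (hSX : S * X = 0) :
    lastCols P X.rank * ((lastCols P X.rank)ᴴ * S * lastCols P X.rank) * (lastCols P X.rank)ᴴ
      = S := by
  have hP : Pᴴ * P = 1 := Matrix.mem_unitaryGroup_iff'.1 h.unitary
  have hP' : P * Pᴴ = 1 := Matrix.mem_unitaryGroup_iff.1 h.unitary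
  have h1 : S * P * rdiag 𝕜 l = 0 := by
    calc S * P * rdiag 𝕜 l = S * (P * rdiag 𝕜 l * Pᴴ) * P := by
          simp only [Matrix.mul_assoc, hP, Matrix.mul_one]
      _ = 0 := by rw [← h.eq, hSX, Matrix.zero_mul]
  have h2 : S * P * Matrix.diagonal (fun i : Fin n => if X.rank ≤ (i : ℕ) then (1 : 𝕜) else 0)
      = S * P := by
    ext i j
    have h3 := congrFun (congrFun h1 i) j
    rw [rdiag, Matrix.mul_diagonal, Matrix.zero_apply] at h3
    rw [Matrix.mul_diagonal]
    by_cases hj : X.rank ≤ (j : ℕ)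
    · simp [hj]
    · have hl : (l j : 𝕜) ≠ 0 := by
        have : l j ≠ 0 := fun h0 => hj ((h.eigenvalue_eq_zero_iff j).1 h0)
        exact_mod_cast this
      rw [(mul_eq_zero.1 h3).resolve_right hl, zero_mul]
  have h4 : S * (lastCols P X.rank * (lastCols P X.rank)ᴴ) = S := by
    rw [lastCols_mul_conjTranspose, ← Matrix.mul_assoc, ← Matrix.mul_assoc, h2, Matrix.mul_assoc,
      hP', Matrix.mul_one]
  have h5 : lastCols P X.rank * (lastCols P X.rank)ᴴ * S = S := by
    have := congrArg Matrix.conjTranspose h4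
    simpa only [Matrix.conjTranspose_mul, Matrix.conjTranspose_conjTranspose, hS.eq] using this
  calc _ = (lastCols P X.rank * (lastCols P X.rank)ᴴ * S)
        * (lastCols P X.rank * (lastCols P X.rank)ᴴ) := by simp only [Matrix.mul_assoc]
    _ = S := by rw [h5, h4]

theorem IsEigenDecomp.exists_det_ne_zero (h : IsEigenDecomp X P l) :
    ∃ A : Matrix (Fin n) (Fin X.rank) 𝕜, (Aᴴ * X * A).det ≠ 0 := by
  have hP : Pᴴ * P = 1 := Matrix.mem_unitaryGroup_iff'.1 h.unitary
  have hr : X.rank ≤ n := (Matrix.rank_le_width X)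
  let e : Fin X.rank → Fin n := Fin.castLE hr
  have hXP : Pᴴ * X * P = rdiag 𝕜 l := by
    conv_lhs => rw [h.eq]
    simp only [Matrix.mul_assoc, hP, Matrix.mul_one]
    rw [← Matrix.mul_assoc, hP, Matrix.one_mul]
  refine ⟨P.submatrix id e, ?_⟩
  have h1 : (P.submatrix id e)ᴴ * X * P.submatrix id e = (rdiag 𝕜 l).submatrix e e := by
    rw [← hXP]
    rfl
  rw [h1, rdiag, Matrix.submatrix_diagonal _ _ (Fin.castLE_injective hr), Matrix.det_diagonal,
    Finset.prod_ne_zero_iff]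
  intro i _
  have : l (e i) ≠ 0 := fun h0 => by
    have h2 := (h.eigenvalue_eq_zero_iff _).1 h0
    have h3 : ((e i : Fin n) : ℕ) = i := rfl
    have := i.isLt
    omega
  simpa using this

end Kernel

/-! ### Rank identification for variational inequalities -/

section Identification

variable {n d : ℕ} {𝕜 : Type*} [RCLike 𝕜] {Θ : Fin d → Matrix (Fin n) (Fin n) 𝕜}

theorem isHermitian_Qdag (hΘ : IsHermitianONB Θ) (p : Fin d → ℝ) (β : Finset (Fin d))
    (X : Matrix (Fin n) (Fin n) 𝕜) : (Qdag Θ p β X).IsHermitian :=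
  isHermitian_sum_smul hΘ β _

theorem trInner_Qdag (hΘ : IsHermitianONB Θ) (p : Fin d → ℝ) (β : Finset (Fin d))
    (X : Matrix (Fin n) (Fin n) 𝕜) (k : Fin d) :
    trInner (Θ k) (Qdag Θ p β X) = if k ∈ β then 1 / p k * trInner (Θ k) X else 0 := by
  rw [Qdag, trInner_sum_right]
  simp [trInner_smul_right, hΘ.orthonormal]

theorem Qdag_congr {p : Fin d → ℝ} {β : Finset (Fin d)} {X Y : Matrix (Fin n) (Fin n) 𝕜}
    (h : ∀ k ∈ β, trInner (Θ k) X = trInner (Θ k) Y) : Qdag Θ p β X = Qdag Θ p β Y :=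
  Finset.sum_congr rfl fun k hk => by rw [h k hk]

/-- The linear system for the multiplier `Λ`. -/
def MultiplierSystem (Θ : Fin d → Matrix (Fin n) (Fin n) 𝕜) (α : Finset (Fin d)) (p : Fin d → ℝ)
    {k : ℕ} (A : Matrix (Fin n) (Fin k) 𝕜) (C : Matrix (Fin n) (Fin n) 𝕜)
    (Λ : Matrix (Fin k) (Fin k) 𝕜) : Prop :=
  Aᴴ * Qdag Θ p αᶜ (A * Λ * Aᴴ) * A = Aᴴ * Qdag Θ p αᶜ C * A

/-- A primal-dual solution of the limiting problem has the multiplier given by the unique positive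
definite solution of the linear system. -/
theorem eq_of_multiplierSystem (hΘ : IsHermitianONB Θ) {α : Finset (Fin d)} {p : Fin d → ℝ}
    (hp : ∀ k ∈ αᶜ, 0 < p k) {k : ℕ} {A : Matrix (Fin n) (Fin k) 𝕜} {C : Matrix (Fin n) (Fin n) 𝕜}
    {Λ₀ Λ : Matrix (Fin k) (Fin k) 𝕜} (hΛ₀ : Λ₀.PosDef) (hsys : MultiplierSystem Θ α p A C Λ₀)
    (huniq : ∀ M : Matrix (Fin k) (Fin k) 𝕜, M.PosDef → MultiplierSystem Θ α p A C M → M = Λ₀)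
    (hΛ : Λ.PosSemidef) {D : Fin d → ℝ} (hDα : ∀ j ∈ α, D j = 0)
    (hstat : ∀ j ∈ αᶜ, p j * D j + trInner (Θ j) C = trInner (Θ j) (A * Λ * Aᴴ))
    (hcompl : ∑ j, D j * trInner (Θ j) (A * Λ * Aᴴ) ≤ 0)
    (hfeas : 0 ≤ ∑ j, D j * trInner (Θ j) (A * Λ₀ * Aᴴ)) : Λ = Λ₀ := by
  set S := A * Λ * Aᴴ with hS
  set S₀ := A * Λ₀ * Aᴴ with hS₀
  set D₀ : Matrix (Fin n) (Fin n) 𝕜 := Qdag Θ p αᶜ S₀ - Qdag Θ p αᶜ C with hD₀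
  have hD₀h : D₀.IsHermitian := (isHermitian_Qdag hΘ p _ _).sub (isHermitian_Qdag hΘ p _ _)
  have hAD : Aᴴ * D₀ * A = 0 := by
    rw [hD₀, Matrix.mul_sub, Matrix.sub_mul, sub_eq_zero]
    exact hsys
  have horth : ∀ M : Matrix (Fin k) (Fin k) 𝕜,
      ∑ j, trInner (Θ j) (A * M * Aᴴ) * trInner (Θ j) D₀ = 0 := fun M => by
    rw [← trInner_eq_sum hΘ _ hD₀h, trInner_conj, hAD, trInner_zero_right]
  have hc : ∀ j, trInner (Θ j) D₀
      = if j ∈ αᶜ then 1 / p j * (trInner (Θ j) S₀ - trInner (Θ j) C) else 0 := fun j => by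
    rw [hD₀, trInner_sub_right, trInner_Qdag hΘ, trInner_Qdag hΘ]
    split_ifs
    · ring
    · ring
  have hterm : ∀ j, 0 ≤ (trInner (Θ j) S - trInner (Θ j) S₀) * (D j - trInner (Θ j) D₀) := by
    intro j
    rw [hc j]
    by_cases hj : j ∈ αᶜ
    · rw [if_pos hj, ← hstat j hj]
      have hpj := hp j hj
      have : (p j * D j + trInner (Θ j) C - trInner (Θ j) S₀)
          * (D j - 1 / p j * (trInner (Θ j) S₀ - trInner (Θ j) C))
          = (p j * D j + trInner (Θ j) C - trInner (Θ j) S₀) ^ 2 / p j := by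
        field_simp
        ring
      rw [this]
      positivity
    · rw [if_neg hj, hDα j (by simpa using hj)]
      simp
  have hsum : ∑ j, (trInner (Θ j) S - trInner (Θ j) S₀) * (D j - trInner (Θ j) D₀) ≤ 0 := by
    have e : ∑ j, (trInner (Θ j) S - trInner (Θ j) S₀) * (D j - trInner (Θ j) D₀)
        = ∑ j, D j * trInner (Θ j) S - ∑ j, D j * trInner (Θ j) S₀
          - ∑ j, trInner (Θ j) S * trInner (Θ j) D₀
          + ∑ j, trInner (Θ j) S₀ * trInner (Θ j) D₀ := by
      simp only [← Finset.sum_sub_distrib, ← Finset.sum_add_distrib]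
      exact Finset.sum_congr rfl fun j _ => by ring
    rw [e, horth Λ, horth Λ₀]
    linarith
  have hzero : ∀ j, (trInner (Θ j) S - trInner (Θ j) S₀) * (D j - trInner (Θ j) D₀) = 0 := fun j =>
    (Finset.sum_eq_zero_iff_of_nonneg fun j _ => hterm j).1
      (le_antisymm hsum (Finset.sum_nonneg fun j _ => hterm j)) j (Finset.mem_univ j)
  have hSS : ∀ j ∈ αᶜ, trInner (Θ j) S = trInner (Θ j) S₀ := by
    intro j hj
    have hpj := hp j hj
    rcases mul_eq_zero.1 (hzero j) with h | h
    · exact sub_eq_zero.1 h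
    · rw [hc j, if_pos hj, sub_eq_zero] at h
      rw [← hstat j hj, h]
      field_simp
      ring
  have hhalf : (0 : ℝ) < 1 / 2 := by norm_num
  -- Uniqueness is assumed only among positive definite solutions, whereas `Λ` is merely
  -- semidefinite. The midpoint with `Λ₀` is definite and still solves the system.
  have hmid : (1 / 2 : ℝ) • Λ₀ + (1 / 2 : ℝ) • Λ = Λ₀ := by
    refine huniq _ ((hΛ₀.smul hhalf).add_posSemidef (hΛ.smul hhalf.le)) ?_
    have e : Qdag Θ p αᶜ (A * ((1 / 2 : ℝ) • Λ₀ + (1 / 2 : ℝ) • Λ) * Aᴴ) = Qdag Θ p αᶜ S₀ := by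
      refine Qdag_congr fun j hj => ?_
      have : A * ((1 / 2 : ℝ) • Λ₀ + (1 / 2 : ℝ) • Λ) * Aᴴ
          = (1 / 2 : ℝ) • S₀ + (1 / 2 : ℝ) • S := by
        rw [Matrix.mul_add, Matrix.add_mul, Matrix.mul_smul, Matrix.mul_smul, Matrix.smul_mul,
          Matrix.smul_mul]
      rw [this, trInner_add_right, trInner_smul_right, trInner_smul_right, hSS j hj]
      ring
    rw [MultiplierSystem, e]
    exact hsys
  have h2 : (1 / 2 : ℝ) • Λ = (1 / 2 : ℝ) • Λ₀ := by
    have : (1 / 2 : ℝ) • Λ₀ + (1 / 2 : ℝ) • Λ = (1 / 2 : ℝ) • Λ₀ + (1 / 2 : ℝ) • Λ₀ := by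
      rw [hmid, ← add_smul]
      norm_num
    exact add_left_cancel this
  exact smul_right_injective _ hhalf.ne' h2

theorem exists_tendsto_of_eventually_abs_le {ι : Type*} (U : Ultrafilter ι) {u : ι → ℝ} {K : ℝ}
    (h : ∀ᶠ i in (U : Filter ι), |u i| ≤ K) : ∃ x, Tendsto u U (𝓝 x) := by
  obtain ⟨x, -, hx⟩ := (isCompact_Icc (a := -K) (b := K)).ultrafilter_le_nhds (U.map u)
    (le_principal_iff.2 (h.mono fun i hi => abs_le.1 hi))
  exact ⟨x, hx⟩

theorem eventually_abs_le_of_tendsto {ι : Type*} {L : Filter ι} {u : ι → ℝ} {x : ℝ}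
    (h : Tendsto u L (𝓝 x)) : ∀ᶠ i in L, |u i| ≤ |x| + 1 :=
  (h.abs.eventually_lt_const (lt_add_one |x|)).mono fun _ hi => hi.le

/-- A quadratic variational inequality tested at the origin gives an a priori bound. -/
theorem sq_le_of_sum_le {ι : Type*} {s : Finset ι} {a p C c D : ι → ℝ} (hp : ∀ k ∈ s, 0 < p k)
    (ha : ∀ k ∈ s, p k / 2 ≤ a k) (hC : ∀ k ∈ s, |C k| ≤ c k)
    (h : ∑ k ∈ s, (a k * D k + C k) * D k ≤ 0) {j : ι} (hj : j ∈ s) :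
    D j ^ 2 ≤ 4 / p j * ∑ k ∈ s, c k ^ 2 / p k := by
  have h1 : ∀ k ∈ s, p k / 4 * D k ^ 2 - c k ^ 2 / p k ≤ (a k * D k + C k) * D k := by
    intro k hk
    have hpk := hp k hk
    have h2 : C k ^ 2 ≤ c k ^ 2 := sq_le_sq.2 ((hC k hk).trans (le_abs_self _))
    have h3 : p k / 2 * D k ^ 2 ≤ a k * D k ^ 2 :=
      mul_le_mul_of_nonneg_right (ha k hk) (sq_nonneg _)
    have h4 : C k ^ 2 / p k ≤ c k ^ 2 / p k := div_le_div_of_nonneg_right h2 hpk.le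
    -- Completing the square spends half of the curvature `p k / 2` on the linear term and leaves `p
    -- k / 4`.
    have h5 : 0 ≤ (p k / 2 * D k + C k) ^ 2 / p k := by positivity
    have h6 : (p k / 2 * D k + C k) ^ 2 / p k = p k / 4 * D k ^ 2 + C k * D k + C k ^ 2 / p k := by
      field_simp
      ring
    nlinarith
  have h2 := Finset.sum_le_sum h1
  rw [Finset.sum_sub_distrib] at h2
  have h3 : p j / 4 * D j ^ 2 ≤ ∑ k ∈ s, p k / 4 * D k ^ 2 :=
    Finset.single_le_sum (f := fun k => p k / 4 * D k ^ 2)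
      (fun k hk => mul_nonneg (div_nonneg (hp k hk).le (by norm_num)) (sq_nonneg _)) hj
  have hpj := hp j hj
  have h4 : D j ^ 2 = 4 / p j * (p j / 4 * D j ^ 2) := by field_simp
  rw [h4]
  exact mul_le_mul_of_nonneg_left (by linarith) (by positivity)

theorem abs_trInner_le_of_posDef {X₀ : Matrix (Fin n) (Fin n) 𝕜} (hX₀ : X₀.PosDef)
    {Y : Matrix (Fin n) (Fin n) 𝕜} (hY : Y.IsHermitian) :
    ∃ t : ℝ, ∀ S : Matrix (Fin n) (Fin n) 𝕜, S.PosSemidef →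
      |trInner Y S| ≤ t * |trInner S X₀| := by
  obtain ⟨t, ht⟩ := exists_smul_add_posSemidef hX₀ hY
  obtain ⟨t', ht'⟩ := exists_smul_add_posSemidef hX₀ hY.neg
  refine ⟨max |t| |t'|, fun S hS => ?_⟩
  have h1 := trInner_nonneg hS ht
  have h2 := trInner_nonneg hS ht'
  rw [← sub_eq_add_neg, trInner_sub_right, trInner_smul_right] at h2
  rw [trInner_add_right, trInner_smul_right] at h1
  have h3 : |t * trInner S X₀| ≤ max |t| |t'| * |trInner S X₀| := by
    rw [abs_mul]; exact mul_le_mul_of_nonneg_right (le_max_left _ _) (abs_nonneg _)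
  have h4 : |t' * trInner S X₀| ≤ max |t| |t'| * |trInner S X₀| := by
    rw [abs_mul]; exact mul_le_mul_of_nonneg_right (le_max_right _ _) (abs_nonneg _)
  rw [trInner_comm, abs_le]
  exact ⟨by linarith [le_abs_self (t * trInner S X₀)],
    by linarith [le_abs_self (t' * trInner S X₀)]⟩

theorem eventually_rank_eq_of_variationalInequality (hΘ : IsHermitianONB Θ) {α : Finset (Fin d)}
    {Xbar : Matrix (Fin n) (Fin n) 𝕜} (hXbar : Xbar.PosSemidef) {p : Fin d → ℝ}
    (hp : ∀ k ∈ αᶜ, 0 < p k) {X₀ : Matrix (Fin n) (Fin n) 𝕜} (hX₀ : X₀.PosDef)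
    (hX₀α : ∀ k ∈ α, trInner (Θ k) X₀ = trInner (Θ k) Xbar)
    {P : Matrix (Fin n) (Fin n) 𝕜} {l : Fin n → ℝ} (hP : IsEigenDecomp Xbar P l)
    {C₀ : Matrix (Fin n) (Fin n) 𝕜}
    {Λ₀ : Matrix (Fin (n - Xbar.rank)) (Fin (n - Xbar.rank)) 𝕜} (hΛ₀ : Λ₀.PosDef)
    (hsys : MultiplierSystem Θ α p (lastCols P Xbar.rank) C₀ Λ₀)
    (huniq : ∀ M : Matrix (Fin (n - Xbar.rank)) (Fin (n - Xbar.rank)) 𝕜, M.PosDef →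
      MultiplierSystem Θ α p (lastCols P Xbar.rank) C₀ M → M = Λ₀)
    {ι : Type*} {L : Filter ι} {a C : ι → Fin d → ℝ} {ρ : ι → ℝ}
    {X : ι → Matrix (Fin n) (Fin n) 𝕜}
    (ha : ∀ k ∈ αᶜ, Tendsto (fun i => a i k) L (𝓝 (p k)))
    (hC : ∀ k ∈ αᶜ, Tendsto (fun i => C i k) L (𝓝 (trInner (Θ k) C₀)))
    (hρ : Tendsto ρ L (𝓝 0)) (hρpos : ∀ᶠ i in L, 0 < ρ i)
    (hX : ∀ᶠ i in L, X i ∈ rcsFeasible Θ α Xbar ∧ ∀ Y ∈ rcsFeasible Θ α Xbar,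
      0 ≤ ∑ k ∈ αᶜ, (a i k * (trInner (Θ k) (X i) - trInner (Θ k) Xbar) + ρ i * C i k)
        * (trInner (Θ k) Y - trInner (Θ k) (X i))) :
    ∀ᶠ i in L, (X i).rank = Xbar.rank := by
  -- Passing to ultrafilters replaces subsequence extraction: bounded real families converge
  -- outright.
  refine mem_iff_ultrafilter.2 fun U hU => ?_
  change ∀ᶠ i in (U : Filter ι), (X i).rank = Xbar.rank
  replace ha := fun k hk => (ha k hk).mono_left hU
  replace hC := fun k hk => (hC k hk).mono_left hU
  replace hρ := hρ.mono_left hU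
  replace hρpos := hρpos.filter_mono hU
  replace hX := hX.filter_mono hU
  clear hU
  set A := lastCols P Xbar.rank with hA
  set D : ι → Fin d → ℝ := fun i k => (trInner (Θ k) (X i) - trInner (Θ k) Xbar) / ρ i with hD
  have hfeas : ∀ᶠ i in (U : Filter ι), X i ∈ rcsFeasible Θ α Xbar := hX.mono fun i hi => hi.1
  have hx : ∀ᶠ i in (U : Filter ι), ∀ k,
      trInner (Θ k) (X i) = trInner (Θ k) Xbar + ρ i * D i k := by
    filter_upwards [hρpos] with i hi k
    rw [hD]
    field_simp
    ring
  have hDα : ∀ᶠ i in (U : Filter ι), ∀ k ∈ α, D i k = 0 := by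
    filter_upwards [hfeas] with i hi k hk
    simp only [hD, hi.2 k hk, sub_self, zero_div]
  have hVI : ∀ᶠ i in (U : Filter ι), ∀ Y ∈ rcsFeasible Θ α Xbar,
      0 ≤ ∑ k ∈ αᶜ, (a i k * D i k + C i k) * (trInner (Θ k) Y - trInner (Θ k) (X i)) := by
    filter_upwards [hX, hx, hρpos] with i hi hxi hρi Y hY
    have h1 := hi.2 Y hY
    have e : ∑ k ∈ αᶜ, (a i k * (trInner (Θ k) (X i) - trInner (Θ k) Xbar) + ρ i * C i k)
        * (trInner (Θ k) Y - trInner (Θ k) (X i))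
        = ρ i * ∑ k ∈ αᶜ, (a i k * D i k + C i k) * (trInner (Θ k) Y - trInner (Θ k) (X i)) := by
      rw [Finset.mul_sum]
      refine Finset.sum_congr rfl fun k _ => ?_
      rw [hxi k]
      ring
    rw [e] at h1
    exact nonneg_of_mul_nonneg_right h1 hρi
  -- boundedness and convergence of the scaled errors
  have hDlim : ∀ k, ∃ x, Tendsto (fun i => D i k) U (𝓝 x) := by
    intro j
    by_cases hj : j ∈ αᶜ
    swap
    · exact ⟨0, tendsto_const_nhds.congr' (hDα.mono fun i hi => (hi j (by simpa using hj)).symm)⟩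
    set B := 4 / p j * ∑ k ∈ αᶜ, (|trInner (Θ k) C₀| + 1) ^ 2 / p k
    have h1 : ∀ᶠ i in (U : Filter ι), ∀ k ∈ αᶜ, p k / 2 ≤ a i k :=
      (Filter.eventually_all_finset _).2 fun k hk =>
        ((ha k hk).eventually_const_lt (half_lt_self (hp k hk))).mono fun _ h => h.le
    have h2 : ∀ᶠ i in (U : Filter ι), ∀ k ∈ αᶜ, |C i k| ≤ |trInner (Θ k) C₀| + 1 :=
      (Filter.eventually_all_finset _).2 fun k hk => eventually_abs_le_of_tendsto (hC k hk)
    refine exists_tendsto_of_eventually_abs_le U (K := √B) ?_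
    filter_upwards [h1, h2, hVI, hx, hρpos] with i h1i h2i hVIi hxi hρi
    refine Real.abs_le_sqrt (sq_le_of_sum_le hp h1i h2i ?_ hj)
    -- The true matrix is feasible, and testing with it yields the a priori bound on the scaled
    -- error.
    have h3 := hVIi Xbar ⟨hXbar, fun _ _ => rfl⟩
    have e : ∑ k ∈ αᶜ, (a i k * D i k + C i k) * (trInner (Θ k) Xbar - trInner (Θ k) (X i))
        = - (ρ i * ∑ k ∈ αᶜ, (a i k * D i k + C i k) * D i k) := by
      rw [Finset.mul_sum, ← Finset.sum_neg_distrib]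
      refine Finset.sum_congr rfl fun k _ => ?_
      rw [hxi k]
      ring
    rw [e] at h3
    by_contra hcon
    have := mul_pos hρi (not_le.1 hcon)
    linarith
  choose D' hD' using hDlim
  have hD'α : ∀ k ∈ α, D' k = 0 := fun k hk =>
    tendsto_nhds_unique (hD' k) (tendsto_const_nhds.congr' (hDα.mono fun i hi => (hi k hk).symm))
  have hxlim : ∀ k, Tendsto (fun i => trInner (Θ k) (X i)) U (𝓝 (trInner (Θ k) Xbar)) := by
    intro k
    have : Tendsto (fun i => trInner (Θ k) Xbar + ρ i * D i k) U
        (𝓝 (trInner (Θ k) Xbar + 0 * D' k)) := tendsto_const_nhds.add (hρ.mul (hD' k))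
    rw [zero_mul, add_zero] at this
    exact this.congr' (hx.mono fun i hi => (hi k).symm)
  have hXlim : Tendsto X U (𝓝 Xbar) := by
    have h1 := ((continuous_synth Θ).tendsto _).comp (tendsto_pi_nhds.2 hxlim)
    rw [synth_trInner hΘ hXbar.1] at h1
    exact h1.congr' (hfeas.mono fun i hi => synth_trInner hΘ hi.1.1)
  -- the multipliers
  have hSex : ∀ᶠ i in (U : Filter ι), ∃ S : Matrix (Fin n) (Fin n) 𝕜,
      S.PosSemidef ∧ trInner S (X i) = 0 ∧
        ∀ k ∈ αᶜ, trInner (Θ k) S = a i k * D i k + C i k := by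
    filter_upwards [hfeas, hVI] with i hi hVIi
    refine exists_multiplier hΘ hi.1 hX₀ (fun k hk => (hX₀α k hk).trans (hi.2 k hk).symm)
      fun Y hY => hVIi Y ⟨hY.1, fun k hk => (hY.2 k hk).trans (hi.2 k hk)⟩
  obtain ⟨S, hS⟩ := hSex.choice
  have hGlim : ∀ k ∈ αᶜ, Tendsto (fun i => a i k * D i k + C i k) U
      (𝓝 (p k * D' k + trInner (Θ k) C₀)) := fun k hk =>
    ((ha k hk).mul (hD' k)).add (hC k hk)
  -- The coordinates of `S i` on `α` are not controlled directly. By complementarity `X₀` may be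
  -- replaced by `X₀ - X i`, which vanishes on `α`, so only the known coordinates remain.
  -- Definiteness of `X₀` then bounds every coordinate of `S i`.
  have hSX₀ : Tendsto (fun i => trInner (S i) X₀) U
      (𝓝 (∑ k ∈ αᶜ, (p k * D' k + trInner (Θ k) C₀)
        * (trInner (Θ k) X₀ - trInner (Θ k) Xbar))) := by
    refine (tendsto_finsetSum αᶜ fun k hk =>
      (hGlim k hk).mul (tendsto_const_nhds.sub (hxlim k))).congr' ?_
    filter_upwards [hS, hfeas] with i hi hfi
    have h1 : trInner (S i) X₀ = trInner (S i) (X₀ - X i) := by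
      rw [trInner_sub_right, hi.2.1, sub_zero]
    rw [h1, trInner_eq_sum hΘ _ (hX₀.1.sub hfi.1.1), ← Finset.sum_compl_add_sum α,
      Finset.sum_eq_zero (s := α), add_zero]
    · exact Finset.sum_congr rfl fun k hk => by rw [hi.2.2 k hk, trInner_sub_right]
    · intro k hk
      rw [trInner_sub_right, hX₀α k hk, hfi.2 k hk, sub_self, mul_zero]
  have hSlim : ∀ k, ∃ x, Tendsto (fun i => trInner (Θ k) (S i)) U (𝓝 x) := by
    intro k
    obtain ⟨t, ht⟩ := abs_trInner_le_of_posDef hX₀ (hΘ.isHermitian k)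
    obtain ⟨x, hx⟩ := exists_tendsto_of_eventually_abs_le U (u := fun i => t * |trInner (S i) X₀|)
      (eventually_abs_le_of_tendsto (hSX₀.abs.const_mul t))
    refine exists_tendsto_of_eventually_abs_le U (K := |x| + 1) ?_
    filter_upwards [hS, eventually_abs_le_of_tendsto hx] with i hi hxi
    exact (ht _ hi.1).trans ((le_abs_self _).trans hxi)
  choose s hs using hSlim
  set S' := synth Θ s with hS'
  have hS'k : ∀ k, trInner (Θ k) S' = s k := trInner_synth hΘ s
  have hStend : Tendsto S U (𝓝 S') := by
    have h1 := ((continuous_synth Θ).tendsto _).comp (tendsto_pi_nhds.2 hs)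
    exact h1.congr' (hS.mono fun i hi => synth_trInner hΘ hi.1.1)
  have hS'psd : S'.PosSemidef :=
    isClosed_posSemidef.mem_of_tendsto hStend (hS.mono fun i hi => hi.1)
  have hS'X : S' * Xbar = 0 := by
    refine tendsto_nhds_unique (hStend.mul hXlim) (tendsto_const_nhds.congr' ?_)
    filter_upwards [hS, hfeas] with i hi hfi
    exact (mul_eq_zero_of_trInner_eq_zero hi.1 hfi.1 hi.2.1).symm
  set Λ := Aᴴ * S' * A with hΛ
  have hΛS : A * Λ * Aᴴ = S' := hP.eq_conj_of_mul_eq_zero hS'psd.1 hS'X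
  have hstat : ∀ k ∈ αᶜ, p k * D' k + trInner (Θ k) C₀ = trInner (Θ k) S' := fun k hk => by
    rw [hS'k]
    exact tendsto_nhds_unique (hGlim k hk) ((hs k).congr' (hS.mono fun i hi => hi.2.2 k hk))
  have hDsum : ∀ᶠ i in (U : Filter ι), ∀ Y : Matrix (Fin n) (Fin n) 𝕜, Y.IsHermitian →
      trInner Y (X i) = trInner Y Xbar + ρ i * ∑ k, D i k * trInner (Θ k) Y := by
    filter_upwards [hfeas, hx] with i hfi hxi Y hY
    rw [trInner_eq_sum hΘ Y hfi.1.1, trInner_eq_sum hΘ Y hXbar.1, Finset.mul_sum,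
      ← Finset.sum_add_distrib]
    exact Finset.sum_congr rfl fun k _ => by rw [hxi k]; ring
  -- Before the limit, `0 = ⟨S i, X i⟩ = ⟨S i, X̄⟩ + ρ ⟨D i, S i⟩` with `⟨S i, X̄⟩ ≥ 0`.
  have hcompl : ∑ k, D' k * trInner (Θ k) S' ≤ 0 := by
    have h1 : Tendsto (fun i => ∑ k, D i k * trInner (Θ k) (S i)) U
        (𝓝 (∑ k, D' k * trInner (Θ k) S')) :=
      tendsto_finsetSum _ fun k _ => by rw [hS'k]; exact (hD' k).mul (hs k)
    refine le_of_tendsto h1 ?_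
    filter_upwards [hS, hDsum, hρpos] with i hi hDi hρi
    have h2 := hDi _ hi.1.1
    rw [hi.2.1] at h2
    have h3 := trInner_nonneg hi.1 hXbar
    by_contra hcon
    have := mul_pos hρi (not_le.1 hcon)
    linarith
  have hAX : Aᴴ * Xbar * A = 0 := by
    rw [Matrix.mul_assoc, hP.mul_lastCols, Matrix.mul_zero]
  have hS₀psd : (A * Λ₀ * Aᴴ).PosSemidef := hΛ₀.posSemidef.mul_mul_conjTranspose_same A
  -- Since `A Λ₀ Aᴴ` is positive semidefinite and orthogonal to `X̄`, its inner product with `X i ⪰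
  -- 0` is `ρ` times the sum before the limit.
  have hfeas' : 0 ≤ ∑ k, D' k * trInner (Θ k) (A * Λ₀ * Aᴴ) := by
    have h1 : Tendsto (fun i => ∑ k, D i k * trInner (Θ k) (A * Λ₀ * Aᴴ)) U
        (𝓝 (∑ k, D' k * trInner (Θ k) (A * Λ₀ * Aᴴ))) :=
      tendsto_finsetSum _ fun k _ => (hD' k).mul_const _
    refine ge_of_tendsto h1 ?_
    filter_upwards [hfeas, hDsum, hρpos] with i hi hDi hρi
    have h2 := hDi _ hS₀psd.1
    rw [trInner_conj _ _ Xbar, hAX, trInner_zero_right, zero_add] at h2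
    have h3 := trInner_nonneg hS₀psd hi.1
    rw [h2] at h3
    exact nonneg_of_mul_nonneg_right h3 hρi
  have hΛeq : Λ = Λ₀ := by
    refine eq_of_multiplierSystem hΘ hp hΛ₀ hsys huniq (hS'psd.conjTranspose_mul_mul_same A)
      hD'α ?_ ?_ hfeas'
    · rwa [hΛS]
    · rwa [hΛS]
  -- conclusion
  have hdet : (Aᴴ * S' * A).det ≠ 0 := by
    rw [← hΛ, hΛeq]
    exact hΛ₀.det_pos.ne'
  obtain ⟨A', hA'⟩ := hP.exists_det_ne_zero
  filter_upwards [eventually_le_rank hStend A hdet, eventually_le_rank hXlim A' hA', hS, hfeas]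
    with i h1 h2 hi hfi
  have h3 := Matrix.rank_add_rank_le_card_of_mul_eq_zero
    (mul_eq_zero_of_trInner_eq_zero hi.1 hfi.1 hi.2.1)
  rw [Fintype.card_fin] at h3
  have h4 := Matrix.rank_le_width Xbar
  omega

end Identification

/-! ### First-order optimality for the rank-correction step -/

section Optimality

variable {n d : ℕ} {𝕜 : Type*} [RCLike 𝕜] {Θ : Fin d → Matrix (Fin n) (Fin n) 𝕜}

/-- The empirical mean of the weights `u i` over those `i < m` with index `k`. -/
def empiricalMean (m : ℕ) (idx : ℕ → Fin d) (u : ℕ → ℝ) (k : Fin d) : ℝ :=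
  (m : ℝ)⁻¹ * ∑ i ∈ Finset.range m, if idx i = k then u i else 0

theorem sum_empiricalMean_mul (m : ℕ) (idx : ℕ → Fin d) (u : ℕ → ℝ) (x : Fin d → ℝ) :
    ∑ k, empiricalMean m idx u k * x k = (m : ℝ)⁻¹ * ∑ i ∈ Finset.range m, u i * x (idx i) := by
  simp only [empiricalMean, mul_assoc, ← Finset.mul_sum, Finset.sum_mul]
  rw [Finset.sum_comm]
  simp

theorem frobNorm_sq_eq_sum (hΘ : IsHermitianONB Θ) {X : Matrix (Fin n) (Fin n) 𝕜}
    (hX : X.IsHermitian) : frobNorm X ^ 2 = ∑ k, trInner (Θ k) X ^ 2 := by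
  have h : trInner X X = ∑ k, trInner (Θ k) X ^ 2 := by
    rw [trInner_eq_sum hΘ X hX]
    exact Finset.sum_congr rfl fun k _ => (sq _).symm
  rw [frobNorm, Real.sq_sqrt, h]
  rw [h]
  exact Finset.sum_nonneg fun k _ => sq_nonneg _

/-- Parseval in the basis `Θ`, centred at the true matrix. The noise is divided by `ρ` so that the
whole linear coefficient carries the factor `ρ`, which matches the scale of the error. -/
theorem rcsObjective_eq (hΘ : IsHermitianONB Θ) {Xbar : Matrix (Fin n) (Fin n) 𝕜} (ν : ℝ)
    (f : (Fin n → ℝ) → (Fin n → ℝ)) (m : ℕ) (idx : ℕ → Fin d) (ξ : ℕ → ℝ) {ρ : ℝ} (hρ : ρ ≠ 0)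
    (γ : ℝ) {Xini : Matrix (Fin n) (Fin n) 𝕜} (hXini : Xini.IsHermitian) :
    ∃ K : ℝ, ∀ X : Matrix (Fin n) (Fin n) 𝕜, X.IsHermitian →
      rcsObjective Θ f m idx (observation Θ Xbar ν idx ξ) ρ γ Xini X
        = K + ∑ k, (1 / 2 * (empiricalMean m idx (fun _ => 1) k + ρ * γ)
              * (trInner (Θ k) X - trInner (Θ k) Xbar) ^ 2
            + ρ * (trInner (Θ k) (1 - spectralOperator f Xini)
                - ν * (empiricalMean m idx ξ k / ρ)
                + γ * (trInner (Θ k) Xbar - trInner (Θ k) Xini))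
              * (trInner (Θ k) X - trInner (Θ k) Xbar)) := by
  refine ⟨1 / (2 * m) * ∑ i ∈ Finset.range m, (ν * ξ i) ^ 2
    + ρ * (∑ k, trInner (Θ k) (1 - spectralOperator f Xini) * trInner (Θ k) Xbar
      + γ / 2 * ∑ k, (trInner (Θ k) Xbar - trInner (Θ k) Xini) ^ 2), fun X hX => ?_⟩
  rw [rcsObjective, frobNorm_sq_eq_sum hΘ (hX.sub hXini), trInner_eq_sum hΘ _ hX]
  have h1 : 1 / (2 * (m : ℝ)) * ∑ i ∈ Finset.range m,
        (observation Θ Xbar ν idx ξ i - trInner (Θ (idx i)) X) ^ 2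
      = 1 / (2 * m) * ∑ i ∈ Finset.range m, (ν * ξ i) ^ 2
        + ∑ k, (1 / 2 * (empiricalMean m idx (fun _ => 1) k
            * (trInner (Θ k) X - trInner (Θ k) Xbar) ^ 2)
          - ν * (empiricalMean m idx ξ k * (trInner (Θ k) X - trInner (Θ k) Xbar))) := by
    rw [Finset.sum_sub_distrib, ← Finset.mul_sum, ← Finset.mul_sum,
      sum_empiricalMean_mul m idx ξ (fun k => trInner (Θ k) X - trInner (Θ k) Xbar),
      sum_empiricalMean_mul m idx (fun _ => 1)
        (fun k => (trInner (Θ k) X - trInner (Θ k) Xbar) ^ 2)]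
    simp only [Finset.mul_sum, ← Finset.sum_sub_distrib, ← Finset.sum_add_distrib]
    refine Finset.sum_congr rfl fun i _ => ?_
    rw [observation, one_div, mul_inv]
    ring
  rw [h1]
  simp only [trInner_sub_right, Finset.mul_sum, ← Finset.sum_add_distrib, mul_add, add_assoc]
  refine congrArg _ ?_
  refine Finset.sum_congr rfl fun k _ => ?_
  field_simp
  ring

theorem nonneg_of_forall_quadratic_nonneg {b c : ℝ}
    (h : ∀ t : ℝ, 0 < t → t ≤ 1 → 0 ≤ t * b + t ^ 2 * c) : 0 ≤ b := by
  have h1 : Tendsto (fun t : ℝ => b + t * c) (𝓝[>] 0) (𝓝 (b + 0 * c)) :=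
    (tendsto_const_nhds.add (tendsto_id.mul_const c)).mono_left nhdsWithin_le_nhds
  rw [zero_mul, add_zero] at h1
  refine ge_of_tendsto h1 ?_
  filter_upwards [Ioc_mem_nhdsGT (zero_lt_one' ℝ)] with t ht
  have h2 := h t ht.1 ht.2
  have e : t * b + t ^ 2 * c = t * (b + t * c) := by ring
  rw [e] at h2
  exact nonneg_of_mul_nonneg_right h2 ht.1

theorem IsRCSSolution.variationalInequality (hΘ : IsHermitianONB Θ) {α : Finset (Fin d)}
    {Xbar : Matrix (Fin n) (Fin n) 𝕜} {ν : ℝ} {f : (Fin n → ℝ) → (Fin n → ℝ)} {m : ℕ}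
    {idx : ℕ → Fin d} {ξ : ℕ → ℝ} {ρ γ : ℝ} (hρ : ρ ≠ 0)
    {Xini X : Matrix (Fin n) (Fin n) 𝕜} (hXini : Xini.IsHermitian)
    (h : IsRCSSolution Θ α Xbar f m idx (observation Θ Xbar ν idx ξ) ρ γ Xini X)
    {Y : Matrix (Fin n) (Fin n) 𝕜} (hY : Y ∈ rcsFeasible Θ α Xbar) :
    0 ≤ ∑ k ∈ αᶜ, ((empiricalMean m idx (fun _ => 1) k + ρ * γ)
          * (trInner (Θ k) X - trInner (Θ k) Xbar)
        + ρ * (trInner (Θ k) (1 - spectralOperator f Xini)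
            - ν * (empiricalMean m idx ξ k / ρ)
            + γ * (trInner (Θ k) Xbar - trInner (Θ k) Xini)))
      * (trInner (Θ k) Y - trInner (Θ k) X) := by
  obtain ⟨K, hK⟩ := rcsObjective_eq hΘ (Xbar := Xbar) ν f m idx ξ hρ γ hXini
  set a : Fin d → ℝ := fun k => empiricalMean m idx (fun _ => 1) k + ρ * γ
  set C : Fin d → ℝ := fun k => trInner (Θ k) (1 - spectralOperator f Xini)
    - ν * (empiricalMean m idx ξ k / ρ) + γ * (trInner (Θ k) Xbar - trInner (Θ k) Xini)
  have hα : ∑ k ∈ α, (a k * (trInner (Θ k) X - trInner (Θ k) Xbar) + ρ * C k)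
      * (trInner (Θ k) Y - trInner (Θ k) X) = 0 :=
    Finset.sum_eq_zero fun k hk => by rw [hY.2 k hk, h.1.2 k hk, sub_self, mul_zero]
  have hsum := Finset.sum_compl_add_sum α fun k =>
    (a k * (trInner (Θ k) X - trInner (Θ k) Xbar) + ρ * C k) * (trInner (Θ k) Y - trInner (Θ k) X)
  rw [hα, add_zero] at hsum
  change 0 ≤ ∑ k ∈ αᶜ, (a k * (trInner (Θ k) X - trInner (Θ k) Xbar) + ρ * C k)
      * (trInner (Θ k) Y - trInner (Θ k) X)
  rw [hsum]
  -- Along the segment from `X` to `Y` the objective increment is a quadratic in `t`; its linear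
  -- coefficient is the asserted sum.
  refine nonneg_of_forall_quadratic_nonneg
    (c := ∑ k, 1 / 2 * a k * (trInner (Θ k) Y - trInner (Θ k) X) ^ 2) fun t ht0 ht1 => ?_
  have hcoef : ∀ k, trInner (Θ k) ((1 - t) • X + t • Y)
      = trInner (Θ k) X + t * (trInner (Θ k) Y - trInner (Θ k) X) := fun k => by
    rw [trInner_add_right, trInner_smul_right, trInner_smul_right]
    ring
  have hfeas : (1 - t) • X + t • Y ∈ rcsFeasible Θ α Xbar :=
    ⟨(h.1.1.smul (sub_nonneg.2 ht1)).add (hY.1.smul ht0.le), fun k hk => by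
      rw [hcoef, hY.2 k hk, h.1.2 k hk, sub_self, mul_zero, add_zero]⟩
  have hmin := h.2 hfeas
  simp only [Set.mem_ofPred_eq] at hmin
  rw [hK _ h.1.1.1, hK _ hfeas.1.1, add_le_add_iff_left, ← sub_nonneg,
    ← Finset.sum_sub_distrib] at hmin
  refine hmin.trans_eq ?_
  rw [Finset.mul_sum, Finset.mul_sum, ← Finset.sum_add_distrib]
  refine Finset.sum_congr rfl fun k _ => ?_
  rw [hcoef]
  ring

end Optimality

/-! ### Convergence in probability as convergence along a filter -/

section ProbFilter

variable {Ω : Type*} [MeasurableSpace Ω] {μ : Measure Ω}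

/-- The filter of events that hold with probability tending to one. -/
def probFilter (μ : Measure Ω) : Filter (ℕ × Ω) where
  sets := {s | Tendsto (fun m => μ {w | (m, w) ∉ s}) atTop (𝓝 0)}
  univ_sets := by simp
  sets_of_superset {s t} hs hst :=
    tendsto_of_tendsto_of_tendsto_of_le_of_le tendsto_const_nhds hs (fun _ => zero_le)
      fun _ => measure_mono fun _ hw hs' => hw (hst hs')
  inter_sets {s t} hs ht := by
    have h := hs.add ht
    rw [add_zero] at h
    refine tendsto_of_tendsto_of_tendsto_of_le_of_le tendsto_const_nhds h (fun _ => zero_le)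
      fun m => (measure_mono fun w hw => ?_).trans (measure_union_le _ _)
    by_contra hcon
    simp only [Set.mem_union, Set.mem_ofPred_eq, not_or, not_not] at hcon
    exact hw hcon

theorem eventually_probFilter {q : ℕ × Ω → Prop} :
    (∀ᶠ z in probFilter μ, q z) ↔ Tendsto (fun m => μ {w | ¬ q (m, w)}) atTop (𝓝 0) := Iff.rfl

theorem eventually_probFilter_of_ae {q : ℕ × Ω → Prop} (h : ∀ m, 1 ≤ m → ∀ᵐ w ∂μ, q (m, w)) :
    ∀ᶠ z in probFilter μ, q z := by
  rw [eventually_probFilter]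
  refine tendsto_const_nhds.congr' ?_
  filter_upwards [eventually_ge_atTop 1] with m hm
  exact (ae_iff.1 (h m hm)).symm

theorem tendsto_fst_probFilter : Tendsto Prod.fst (probFilter μ) atTop := by
  intro s hs
  refine (tendsto_const_nhds (x := (0 : ENNReal))).congr' ?_
  filter_upwards [hs] with m hm
  simp [hm]

theorem tendsto_probFilter_of_tendstoInMeasure {u : ℕ → Ω → ℝ} {c : ℝ}
    (h : TendstoInMeasure μ u atTop fun _ => c) :
    Tendsto (fun z : ℕ × Ω => u z.1 z.2) (probFilter μ) (𝓝 c) := by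
  rw [tendstoInMeasure_iff_dist] at h
  rw [Metric.tendsto_nhds]
  intro ε hε
  rw [eventually_probFilter]
  simpa only [not_lt] using h ε hε

theorem BoundedInProbability.tendsto_mul_zero {γ : ℕ → Ω → ℝ} (hγ : BoundedInProbability μ γ)
    {u : ℕ × Ω → ℝ} (hu : Tendsto u (probFilter μ) (𝓝 0)) :
    Tendsto (fun z => γ z.1 z.2 * u z) (probFilter μ) (𝓝 0) := by
  rw [Metric.tendsto_nhds]
  intro ε hε
  rw [eventually_probFilter, ENNReal.tendsto_nhds_zero]
  intro η hη
  obtain ⟨M, hM⟩ := hγ (η / 2) (ENNReal.half_pos hη.ne')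
  have h1 : 0 < |M| + 1 := by positivity
  have h2 := (Metric.tendsto_nhds.1 hu) (ε / (|M| + 1)) (by positivity)
  rw [eventually_probFilter, ENNReal.tendsto_nhds_zero] at h2
  filter_upwards [hM, h2 (η / 2) (ENNReal.half_pos hη.ne')] with m hm1 hm2
  rw [← ENNReal.add_halves η]
  -- The product can reach `ε` only if `|γ|` exceeds `M` or `|u|` reaches `ε / (|M| + 1)`.
  refine ((measure_mono fun w hw => ?_).trans (measure_union_le _ _)).trans (add_le_add hm1 hm2)
  by_contra hcon
  simp only [Set.mem_union, Set.mem_ofPred_eq, not_or, not_lt, dist_zero_right,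
    Real.norm_eq_abs] at hcon hw
  refine absurd hw (not_le.2 ?_)
  rw [abs_mul]
  calc |γ m w| * |u (m, w)| ≤ (|M| + 1) * |u (m, w)| := by
        refine mul_le_mul_of_nonneg_right ?_ (abs_nonneg _)
        linarith [hcon.1, le_abs_self M]
    _ < (|M| + 1) * (ε / (|M| + 1)) := mul_lt_mul_of_pos_left (not_le.1 hcon.2) h1
    _ = ε := by field_simp

theorem tendsto_measure_of_eventually_probFilter [IsProbabilityMeasure μ] {q : ℕ × Ω → Prop}
    (h : ∀ᶠ z in probFilter μ, q z) : Tendsto (fun m => μ {w | q (m, w)}) atTop (𝓝 1) := by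
  rw [eventually_probFilter] at h
  have h1 : Tendsto (fun m => 1 - μ {w | ¬ q (m, w)}) atTop (𝓝 (1 - 0)) :=
    ENNReal.Tendsto.sub tendsto_const_nhds h (Or.inl ENNReal.one_ne_top)
  rw [tsub_zero] at h1
  refine tendsto_of_tendsto_of_tendsto_of_le_of_le h1 tendsto_const_nhds (fun m => ?_)
    fun m => prob_le_one
  -- Only subadditivity is used, so the event need not be measurable.
  rw [tsub_le_iff_right, ← measure_univ (μ := μ)]
  refine (measure_mono fun w _ => ?_).trans (measure_union_le _ _)
  by_cases hw : q (m, w)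
  · exact Or.inl hw
  · exact Or.inr hw

end ProbFilter

/-! ### Empirical means of the sampling scheme -/

section Sampling

variable {d : ℕ} {Ω : Type*} [MeasurableSpace Ω] {μ : Measure Ω} {p : Fin d → ℝ}
  {idx : ℕ → Ω → Fin d} {ξ : ℕ → Ω → ℝ}

theorem IsSampling.tendsto_frequency [IsProbabilityMeasure μ] (h : IsSampling μ p idx ξ)
    {k : Fin d} (hk : 0 ≤ p k) :
    Tendsto (fun z : ℕ × Ω => empiricalMean z.1 (fun i => idx i z.2) (fun _ => 1) k)
      (probFilter μ) (𝓝 (p k)) := by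
  let g : Fin d → ℝ := fun j => if j = k then 1 else 0
  have hg : Measurable g := measurable_of_finite g
  have hident : ∀ i, IdentDistrib (idx i) (idx 0) μ μ := fun i =>
    ⟨(h.measurable_idx i).aemeasurable, (h.measurable_idx 0).aemeasurable, by
      refine Measure.ext_of_singleton fun j => ?_
      rw [Measure.map_apply (h.measurable_idx i) (measurableSet_singleton j),
        Measure.map_apply (h.measurable_idx 0) (measurableSet_singleton j)]
      exact (h.law_idx i j).trans (h.law_idx 0 j).symm⟩
  have hmeas : ∀ i, Measurable (g ∘ idx i) := fun i => hg.comp (h.measurable_idx i)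
  have hset : g ∘ idx 0 = Set.indicator {w | idx 0 w = k} fun _ => (1 : ℝ) := by
    ext w
    simp [g, Set.indicator_apply]
  have hms : MeasurableSet {w | idx 0 w = k} := h.measurable_idx 0 (measurableSet_singleton k)
  have hint : Integrable (g ∘ idx 0) μ := by
    rw [hset]
    exact (integrable_const 1).indicator hms
  have hmean : ∫ w, (g ∘ idx 0) w ∂μ = p k := by
    rw [hset, integral_indicator_const _ hms, Measure.real, h.law_idx, ENNReal.toReal_ofReal hk,
      smul_eq_mul, mul_one]
  have hlaw := strong_law_ae (μ := μ) (fun i => g ∘ idx i) hint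
    (fun i j hij => (h.indep_idx.indepFun hij).comp hg hg) fun i => (hident i).comp hg
  rw [hmean] at hlaw
  refine tendsto_probFilter_of_tendstoInMeasure
    (u := fun m w => empiricalMean m (fun i => idx i w) (fun _ => 1) k)
    (tendstoInMeasure_of_tendsto_ae (fun m => ?_) hlaw)
  have hm : Measurable fun w => (m : ℝ)⁻¹ • ∑ i ∈ Finset.range m, (g ∘ idx i) w :=
    (Finset.measurable_fun_sum _ fun i _ => hmeas i).const_smul (m : ℝ)⁻¹
  exact hm.aestronglyMeasurable

/-- The terms `ξ i · 1{idx i = k}` are pairwise orthogonal with second moment at most one: the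
noises are centred, mutually independent and independent of the indices. -/
theorem IsSampling.integral_sq_empiricalMean_le [IsProbabilityMeasure μ] (h : IsSampling μ p idx ξ)
    (k : Fin d) (m : ℕ) :
    MemLp (fun w => empiricalMean m (fun i => idx i w) (fun i => ξ i w) k) 2 μ ∧
    ∫ w, empiricalMean m (fun i => idx i w) (fun i => ξ i w) k ^ 2 ∂μ ≤ (m : ℝ)⁻¹ := by
  let g : Fin d → ℝ := fun j => if j = k then 1 else 0
  have hg : Measurable g := measurable_of_finite g
  have hgb : ∀ j, g j = 0 ∨ g j = 1 := fun j => by by_cases hj : j = k <;> simp [g, hj]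
  let Z : ℕ → Ω → ℝ := fun i w => ξ i w * g (idx i w)
  have hξ2 : ∀ i, MemLp (ξ i) 2 μ := fun i => (h.identDistrib_noise i).memLp_iff.2 h.memLp_noise
  have hgm : ∀ i, Measurable fun w => g (idx i w) := fun i => hg.comp (h.measurable_idx i)
  have hZ2 : ∀ i, MemLp (Z i) 2 μ := fun i => by
    refine (hξ2 i).mono ((h.measurable_noise i).mul (hgm i)).aestronglyMeasurable
      (ae_of_all _ fun w => ?_)
    simp only [Z]
    rcases hgb (idx i w) with h0 | h0 <;> simp [h0]
  have hZint : ∀ i j, Integrable (fun w => Z i w * Z j w) μ := fun i j =>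
    (hZ2 i).integrable_mul (hZ2 j)
  have hmean : ∀ i, ∫ w, ξ i w ∂μ = 0 := fun i =>
    (h.identDistrib_noise i).integral_eq.trans h.mean_noise
  have hsecond : ∀ i, ∫ w, ξ i w ^ 2 ∂μ = 1 := fun i =>
    ((h.identDistrib_noise i).comp (measurable_id.pow_const 2)).integral_eq.trans
      h.second_moment_noise
  have hcross : ∀ i j, i ≠ j → ∫ w, Z i w * Z j w ∂μ = 0 := by
    intro i j hij
    have h1 : IndepFun (fun w => ξ i w * ξ j w) (fun w => g (idx i w) * g (idx j w)) μ :=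
      h.indep_noise_idx.comp (φ := fun x : ℕ → ℝ => x i * x j)
        (ψ := fun x : ℕ → Fin d => g (x i) * g (x j))
        ((measurable_pi_apply i).mul (measurable_pi_apply j))
        ((hg.comp (measurable_pi_apply i)).mul (hg.comp (measurable_pi_apply j)))
    have h2 : ∫ w, ξ i w * ξ j w ∂μ = 0 := by
      have := (h.indep_noise.indepFun hij).integral_fun_mul_eq_mul_integral
        (h.measurable_noise i).aestronglyMeasurable (h.measurable_noise j).aestronglyMeasurable
      rw [this, hmean, zero_mul]
    have h3 := h1.integral_fun_mul_eq_mul_integral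
      ((h.measurable_noise i).mul (h.measurable_noise j)).aestronglyMeasurable
      ((hgm i).mul (hgm j)).aestronglyMeasurable
    rw [h2, zero_mul] at h3
    rw [← h3]
    refine integral_congr_ae (ae_of_all _ fun w => ?_)
    simp only [Z]
    ring
  have hdiag : ∀ i, ∫ w, Z i w * Z i w ∂μ ≤ 1 := by
    intro i
    rw [← hsecond i]
    refine integral_mono (hZint i i) (hξ2 i).integrable_sq fun w => ?_
    simp only [Z]
    rcases hgb (idx i w) with h0 | h0
    · rw [h0]; nlinarith [sq_nonneg (ξ i w)]
    · rw [h0]; exact (by ring : _ = _).le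
  have hE : (fun w => empiricalMean m (fun i => idx i w) (fun i => ξ i w) k)
      = fun w => (m : ℝ)⁻¹ * ∑ i ∈ Finset.range m, Z i w := by
    ext w
    simp [empiricalMean, Z, g]
  constructor
  · rw [hE]
    exact (memLp_finsetSum _ fun i _ => hZ2 i).const_mul _
  · have h1 : ∀ w, empiricalMean m (fun i => idx i w) (fun i => ξ i w) k ^ 2
        = (m : ℝ)⁻¹ ^ 2 * ∑ i ∈ Finset.range m, ∑ j ∈ Finset.range m, Z i w * Z j w := fun w => by
      rw [congrFun hE w, mul_pow, sq (∑ i ∈ Finset.range m, Z i w), Finset.sum_mul_sum]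
    simp only [h1]
    rw [integral_const_mul, integral_finsetSum _ fun i _ => integrable_finsetSum _ fun j _ =>
      hZint i j]
    have h2 : ∑ i ∈ Finset.range m, ∫ w, ∑ j ∈ Finset.range m, Z i w * Z j w ∂μ ≤ m := by
      calc ∑ i ∈ Finset.range m, ∫ w, ∑ j ∈ Finset.range m, Z i w * Z j w ∂μ
          ≤ ∑ i ∈ Finset.range m, (1 : ℝ) := by
            refine Finset.sum_le_sum fun i hi => ?_
            rw [integral_finsetSum _ fun j _ => hZint i j,
              Finset.sum_eq_single_of_mem i hi fun j _ hji => hcross i j hji.symm]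
            exact hdiag i
        _ = m := by simp
    rcases Nat.eq_zero_or_pos m with rfl | hm
    · simp
    · have hm' : (0 : ℝ) < m := by exact_mod_cast hm
      calc (m : ℝ)⁻¹ ^ 2 * _ ≤ (m : ℝ)⁻¹ ^ 2 * m := mul_le_mul_of_nonneg_left h2 (sq_nonneg _)
        _ = (m : ℝ)⁻¹ := by field_simp

/-- Chebyshev's inequality bounds the probability of a deviation of size `ε` by `1 / (ε √m ρ)²`. -/
theorem IsSampling.tendsto_noise [IsProbabilityMeasure μ] (h : IsSampling μ p idx ξ) (k : Fin d)
    {ρ : ℕ → ℝ} (hρ_pos : ∀ m, 1 ≤ m → 0 < ρ m)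
    (hρ : Tendsto (fun m : ℕ => √m * ρ m) atTop atTop) :
    Tendsto (fun z : ℕ × Ω =>
      empiricalMean z.1 (fun i => idx i z.2) (fun i => ξ i z.2) k / ρ z.1)
      (probFilter μ) (𝓝 0) := by
  rw [Metric.tendsto_nhds]
  intro ε hε
  rw [eventually_probFilter]
  have hlim : Tendsto (fun m : ℕ => ENNReal.ofReal ((ε ^ 2)⁻¹ * ((√m * ρ m) ^ 2)⁻¹)) atTop
      (𝓝 0) := by
    have h1 : Tendsto (fun m : ℕ => ((√m * ρ m) ^ 2)⁻¹) atTop (𝓝 0) :=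
      tendsto_inv_atTop_zero.comp ((tendsto_pow_atTop two_ne_zero).comp hρ)
    have h2 := ENNReal.tendsto_ofReal (h1.const_mul (ε ^ 2)⁻¹)
    rwa [mul_zero, ENNReal.ofReal_zero] at h2
  refine tendsto_of_tendsto_of_tendsto_of_le_of_le' tendsto_const_nhds hlim
    (Eventually.of_forall fun _ => zero_le) ?_
  filter_upwards [eventually_ge_atTop 1] with m hm
  obtain ⟨hmem, hle⟩ := h.integral_sq_empiricalMean_le k m
  have hρm := hρ_pos m hm
  have hm' : (0 : ℝ) < m := by exact_mod_cast hm
  have hmk := mul_meas_ge_le_integral_of_nonneg (μ := μ)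
    (ae_of_all _ fun w => sq_nonneg (empiricalMean m (fun i => idx i w) (fun i => ξ i w) k))
    hmem.integrable_sq ((ε * ρ m) ^ 2)
  have hsub : {w | ¬ dist (empiricalMean m (fun i => idx i w) (fun i => ξ i w) k / ρ m) 0 < ε}
      ⊆ {w | (ε * ρ m) ^ 2 ≤ empiricalMean m (fun i => idx i w) (fun i => ξ i w) k ^ 2} := by
    intro w hw
    simp only [Set.mem_ofPred_eq, not_lt, dist_zero_right, Real.norm_eq_abs, abs_div,
      abs_of_pos hρm, le_div_iff₀ hρm] at hw ⊢
    rw [sq_le_sq, abs_of_pos (mul_pos hε hρm)]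
    exact hw
  refine (measure_mono hsub).trans ?_
  rw [← ENNReal.ofReal_toReal (measure_ne_top μ _)]
  refine ENNReal.ofReal_le_ofReal ?_
  have hpos : 0 < (ε * ρ m) ^ 2 := by positivity
  have hfin : (ε * ρ m) ^ 2 * (μ {w | (ε * ρ m) ^ 2
      ≤ empiricalMean m (fun i => idx i w) (fun i => ξ i w) k ^ 2}).toReal ≤ (m : ℝ)⁻¹ :=
    hmk.trans hle
  calc _ ≤ (m : ℝ)⁻¹ / (ε * ρ m) ^ 2 := by rwa [le_div_iff₀ hpos, mul_comm]
    _ = (ε ^ 2)⁻¹ * ((√m * ρ m) ^ 2)⁻¹ := by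
      rw [mul_pow (√m), Real.sq_sqrt hm'.le]
      field_simp

end Sampling

/-! ### Consistency of the initial estimator -/

section InitialEstimator

variable {n d : ℕ} {𝕜 : Type*} [RCLike 𝕜] {Θ : Fin d → Matrix (Fin n) (Fin n) 𝕜}
  {Ω : Type*} [MeasurableSpace Ω] {μ : Measure Ω}

theorem abs_trInner_le_frobNorm (hΘ : IsHermitianONB Θ) {X : Matrix (Fin n) (Fin n) 𝕜}
    (hX : X.IsHermitian) (k : Fin d) : |trInner (Θ k) X| ≤ frobNorm X := by
  refine abs_le_of_sq_le_sq ?_ (Real.sqrt_nonneg _)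
  rw [frobNorm_sq_eq_sum hΘ hX]
  exact Finset.single_le_sum (f := fun k => trInner (Θ k) X ^ 2) (fun k _ => sq_nonneg _)
    (Finset.mem_univ k)

/-- The limit is taken within the Hermitian matrices because the spectral operator is assumed
continuous only there. -/
theorem TendstoInProbability.tendsto_probFilter (hΘ : IsHermitianONB Θ)
    {X : ℕ → Ω → Matrix (Fin n) (Fin n) 𝕜} {Xbar : Matrix (Fin n) (Fin n) 𝕜}
    (h : TendstoInProbability μ X Xbar) (hXbar : Xbar.IsHermitian)
    (hX : ∀ᶠ z in probFilter μ, (X z.1 z.2).IsHermitian) :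
    Tendsto (fun z : ℕ × Ω => X z.1 z.2) (probFilter μ) (𝓝[{X | X.IsHermitian}] Xbar) := by
  have h0 := tendsto_probFilter_of_tendstoInMeasure h
  have h1 : ∀ k, Tendsto (fun z : ℕ × Ω => trInner (Θ k) (X z.1 z.2)) (probFilter μ)
      (𝓝 (trInner (Θ k) Xbar)) := by
    intro k
    rw [tendsto_iff_norm_sub_tendsto_zero]
    refine squeeze_zero' (Eventually.of_forall fun _ => norm_nonneg _) ?_ h0
    filter_upwards [hX] with z hz
    rw [← trInner_sub_right]
    exact abs_trInner_le_frobNorm hΘ (hz.sub hXbar) k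
  have h2 := ((continuous_synth Θ).tendsto _).comp (tendsto_pi_nhds.2 h1)
  rw [synth_trInner hΘ hXbar] at h2
  exact tendsto_nhdsWithin_iff.2 ⟨h2.congr' (hX.mono fun z hz => synth_trInner hΘ hz), hX⟩

end InitialEstimator

end RankCorrection

end

open RankCorrection in
theorem theorem4 {𝕜 : Type*} [RCLike 𝕜] {n d : ℕ}
    -- the orthonormal basis, the fixed indices, the unknown matrix
    (Θ : Fin d → Matrix (Fin n) (Fin n) 𝕜) (hΘ : IsHermitianONB Θ)
    (α : Finset (Fin d))
    (Xbar : Matrix (Fin n) (Fin n) 𝕜) (hXbar : Xbar.PosSemidef) (hr : 1 ≤ Xbar.rank)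
    -- the sampling probabilities, the sampled indices and the noises
    (p : Fin d → ℝ) (hpα : ∀ k ∈ α, p k = 0) (hpβ : ∀ k ∈ αᶜ, 0 < p k)
    {Ω : Type*} [MeasurableSpace Ω] (μ : Measure Ω) [IsProbabilityMeasure μ]
    (idx : ℕ → Ω → Fin d) (ξ : ℕ → Ω → ℝ) (hsampling : IsSampling μ p idx ξ)
    (ν : ℝ) (hν : 0 < ν)
    -- the spectral operator
    (f : (Fin n → ℝ) → (Fin n → ℝ)) (hf : IsSymmetricFun f)
    (hF : ContinuousWithinAt (spectralOperator f) {X | X.IsHermitian} Xbar)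
    -- the initial estimator
    (Xini : ℕ → Ω → Matrix (Fin n) (Fin n) 𝕜) (hXini_meas : ∀ m, IsRandomMatrix (Xini m))
    (hXini_psd : ∀ m, 1 ≤ m → ∀ᵐ w ∂μ, (Xini m w).PosSemidef)
    (hXini_tendsto : TendstoInProbability μ Xini Xbar)
    -- the regularization parameters
    (ρ : ℕ → ℝ) (hρ_pos : ∀ m, 1 ≤ m → 0 < ρ m)
    (hρ_zero : Tendsto ρ atTop (𝓝 0))
    (hρ_slow : Tendsto (fun m : ℕ => Real.sqrt m * ρ m) atTop atTop)
    (γ : ℕ → Ω → ℝ) (hγ_meas : ∀ m, Measurable (γ m))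
    (hγ_nonneg : ∀ m, 1 ≤ m → ∀ᵐ w ∂μ, 0 ≤ γ m w)
    (hγ_bdd : BoundedInProbability μ γ)
    -- the estimator generated from the rank-correction step
    (Xhat : ℕ → Ω → Matrix (Fin n) (Fin n) 𝕜) (hXhat_meas : ∀ m, IsRandomMatrix (Xhat m))
    (hXhat : ∀ m, 1 ≤ m → ∀ᵐ w ∂μ,
      IsRCSSolution Θ α Xbar f m (fun i => idx i w)
        (observation Θ Xbar ν (fun i => idx i w) (fun i => ξ i w))
        (ρ m) (γ m w) (Xini m w) (Xhat m w))
    -- the Slater condition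
    (hSlater : ∃ X₀ : Matrix (Fin n) (Fin n) 𝕜, X₀.PosDef ∧
      ∀ k ∈ α, trInner (Θ k) X₀ = trInner (Θ k) Xbar)
    -- an eigenvalue decomposition of the unknown matrix
    (P : Matrix (Fin n) (Fin n) 𝕜) (l : Fin n → ℝ) (hP : IsEigenDecomp Xbar P l)
    -- the linear system has a unique positive definite solution
    (hsystem : ∃! Λ : Matrix (Fin (n - Xbar.rank)) (Fin (n - Xbar.rank)) 𝕜, Λ.PosDef ∧
      (lastCols P Xbar.rank)ᴴ
          * Qdag Θ p αᶜ (lastCols P Xbar.rank * Λ * (lastCols P Xbar.rank)ᴴ)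
          * lastCols P Xbar.rank
        = (lastCols P Xbar.rank)ᴴ * Qdag Θ p αᶜ (1 - spectralOperator f Xbar)
          * lastCols P Xbar.rank) :
    RankConsistent μ Xhat Xbar := by
  obtain ⟨X₀, hX₀, hX₀α⟩ := hSlater
  obtain ⟨Λ₀, ⟨hΛ₀, hsys⟩, huniq⟩ := hsystem
  have hfst : Tendsto (Prod.fst : ℕ × Ω → ℕ) (probFilter μ) atTop := tendsto_fst_probFilter
  have hρL : Tendsto (fun z : ℕ × Ω => ρ z.1) (probFilter μ) (𝓝 0) := hρ_zero.comp hfst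
  have hρL_pos : ∀ᶠ z : ℕ × Ω in probFilter μ, 0 < ρ z.1 :=
    (hfst.eventually (eventually_ge_atTop 1)).mono fun z hz => hρ_pos z.1 hz
  have hini : ∀ᶠ z : ℕ × Ω in probFilter μ, (Xini z.1 z.2).PosSemidef :=
    eventually_probFilter_of_ae hXini_psd
  have hini_tendsto := hXini_tendsto.tendsto_probFilter hΘ hXbar.1 (hini.mono fun z hz => hz.1)
  have hF' := hF.tendsto.comp hini_tendsto
  have hcoef : ∀ k, Tendsto (fun z : ℕ × Ω => trInner (Θ k) (Xini z.1 z.2)) (probFilter μ)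
      (𝓝 (trInner (Θ k) Xbar)) := fun k =>
    ((continuous_trInner (Θ k)).tendsto _).comp (tendsto_nhdsWithin_iff.1 hini_tendsto).1
  suffices h : ∀ᶠ z : ℕ × Ω in probFilter μ, (Xhat z.1 z.2).rank = Xbar.rank from
    tendsto_measure_of_eventually_probFilter h
  have huniq' : ∀ M : Matrix (Fin (n - Xbar.rank)) (Fin (n - Xbar.rank)) 𝕜, M.PosDef →
      MultiplierSystem Θ α p (lastCols P Xbar.rank) (1 - spectralOperator f Xbar) M → M = Λ₀ :=
    fun M hM hMsys => huniq M ⟨hM, hMsys⟩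
  refine eventually_rank_eq_of_variationalInequality hΘ hXbar hpβ hX₀ hX₀α hP
    (C₀ := 1 - spectralOperator f Xbar) hΛ₀ hsys huniq' (L := probFilter μ)
    (a := fun z k => empiricalMean z.1 (fun i => idx i z.2) (fun _ => 1) k + ρ z.1 * γ z.1 z.2)
    (C := fun z k => trInner (Θ k) (1 - spectralOperator f (Xini z.1 z.2))
      - ν * (empiricalMean z.1 (fun i => idx i z.2) (fun i => ξ i z.2) k / ρ z.1)
      + γ z.1 z.2 * (trInner (Θ k) Xbar - trInner (Θ k) (Xini z.1 z.2)))
    (ρ := fun z => ρ z.1) (X := fun z => Xhat z.1 z.2) ?_ ?_ hρL hρL_pos ?_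
  · intro k hk
    -- The proximal term adds the curvature `ρ γ`, which is negligible because `γ` is bounded in
    -- probability.
    have h := (hsampling.tendsto_frequency (hpβ k hk).le).add (hγ_bdd.tendsto_mul_zero hρL)
    rw [add_zero] at h
    simpa only [mul_comm] using h
  · intro k _
    have h1 : Tendsto (fun z : ℕ × Ω => trInner (Θ k) (1 - spectralOperator f (Xini z.1 z.2)))
        (probFilter μ) (𝓝 (trInner (Θ k) (1 - spectralOperator f Xbar))) :=
      ((continuous_trInner (Θ k)).tendsto _).comp (tendsto_const_nhds.sub hF')
    have h2 := (hsampling.tendsto_noise k hρ_pos hρ_slow).const_mul ν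
    have h3 := hγ_bdd.tendsto_mul_zero (u := fun z => trInner (Θ k) Xbar
      - trInner (Θ k) (Xini z.1 z.2)) (by
        have := (tendsto_const_nhds (x := trInner (Θ k) Xbar)).sub (hcoef k)
        rwa [sub_self] at this)
    have h := (h1.sub h2).add h3
    rwa [mul_zero, sub_zero, add_zero] at h
  · have hsol : ∀ᶠ z : ℕ × Ω in probFilter μ,
        IsRCSSolution Θ α Xbar f z.1 (fun i => idx i z.2)
          (observation Θ Xbar ν (fun i => idx i z.2) (fun i => ξ i z.2))
          (ρ z.1) (γ z.1 z.2) (Xini z.1 z.2) (Xhat z.1 z.2) :=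
      eventually_probFilter_of_ae hXhat
    filter_upwards [hsol, hini, hρL_pos] with z hz hzini hzρ
    exact ⟨hz.1, fun Y hY => hz.variationalInequality hΘ hzρ.ne' hzini.1 hY⟩
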